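/- Throughout, functions on $\mathbb R^N$ are complex valued, $C_0(\mathbb R^N)$ is the space of continuous functions vanishing at infinity with the sup norm, $C_c^\infty(\mathbb R^N)$ is the space of smooth compactly supported functions, $e^{t\Delta}$ is the heat semigroup, and $H^s(\mathbb R^N)$, $s\ge 0$, is the usual Sobolev space with norm $\|f\|_{H^s}=\|\mathcal F^{-1}[(1+|\xi|^2)^{s/2}\hat f\,]\|_{L^2}$. For $\alpha>0$, $\lambda\in\mathbb C$ and $\varphi\in C_0(\mathbb R^N)$ consider the Cauchy problem $$u_t=\Delta u+\lambda|u|^\alpha u,\qquad u(0,\cdot)=\varphi .\tag{NLH}$$ A solution on $[0,T)$ is a function $u\in C([0,T),C_0(\mathbb R^N))$ such that $$u(t)=e^{t\Delta}\varphi+\lambda\int_0^t e^{(t-\sigma)\Delta}\bigl(|u(\sigma)|^\alpha u(\sigma)\bigr)\,d\sigma\qquad(0\le t<T).$$ Let $T_{\max}(\varphi)\in(0,\infty]$ be the maximal existence time, that is, the supremum of all $T$ for which there is a solution on $[0,T)$; the corresponding solution of (NLH) is the solution on $[0,T_{\max}(\varphi))$. Definition. Let $s\ge 0$. The problem (NLH)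 is locally well posed for small data in $H^s(\mathbb R^N)$ if there exist $\delta,T>0$ such that, whenever $\varphi\in C_c^\infty(\mathbb R^N)$ and $\|\varphi\|_{H^s}\le\delta$, one has $T_{\max}(\varphi)\ge T$ and the corresponding solution $u\in C([0,T_{\max}(\varphi)),C_0(\mathbb R^N))$ satisfies $u(t)\in H^s(\mathbb R^N)$ for all $0\le t\le T$ with $t<T_{\max}(\varphi)$. Theorem. Let $0<\alpha<2$, let $\lambda>0$ be real, and let $N$ be a positive integer with $$N>11+\frac4\alpha .$$ Then for every $s\ge 0$ the Cauchy problem (NLH) is not locally well posed for small data in $H^s(\mathbb R^N)$. -/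

import Mathlib

open MeasureTheory Set TemperedDistribution
open scoped ENNReal ZeroAtInfty SchwartzMap ContDiff

noncomputable section

namespace NLHeat

/-- The space `ℝ^N` with its Euclidean norm. -/
abbrev Space (N : ℕ) : Type := EuclideanSpace ℝ (Fin N)

/-- The Gaussian heat kernel `(4πt)^(-N/2) exp(-|x|²/(4t))`, used for `t > 0`. -/
def heatKernel {N : ℕ} (t : ℝ) (x : Space N) : ℝ :=
  (4 * Real.pi * t) ^ (-(N : ℝ) / 2) * Real.exp (-‖x‖ ^ 2 / (4 * t))

/-- The heat semigroup `e^{tΔ}`, `t ≥ 0`: convolution with the heat kernel for `t > 0`, and the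
identity for `t = 0`. -/
def heatSemigroup {N : ℕ} (t : ℝ) (f : Space N → ℂ) (x : Space N) : ℂ :=
  if 0 < t then ∫ y, (heatKernel t (x - y) : ℂ) * f y else f x

/-- `u ∈ C([0, T), C₀(ℝ^N))` (with `0 ≤ T ≤ ∞`) is a solution on `[0, T)` of
`u_t = Δu + lam |u|^α u`, `u(0) = φ`, in the standard sense of Duhamel's formula
`u(t) = e^{tΔ} φ + lam ∫₀ᵗ e^{(t-σ)Δ} (|u(σ)|^α u(σ)) dσ` for `0 ≤ t < T`. -/
structure IsSolutionOn {N : ℕ} (α : ℝ) (lam : ℂ) (φ : C₀(Space N, ℂ)) (T : ℝ≥0∞)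
    (u : ℝ → C₀(Space N, ℂ)) : Prop where
  continuousOn : ContinuousOn u {t : ℝ | 0 ≤ t ∧ ENNReal.ofReal t < T}
  duhamel : ∀ t : ℝ, 0 ≤ t → ENNReal.ofReal t < T → ∀ x : Space N,
    u t x = heatSemigroup t φ x + lam * ∫ σ in (0 : ℝ)..t,
      heatSemigroup (t - σ) (fun y ↦ ((‖u σ y‖ ^ α : ℝ) : ℂ) * u σ y) x

/-- The maximal existence time in `C₀(ℝ^N)`: the supremum of the `T ∈ [0, ∞]` such that there is
a solution on `[0, T)`. -/
def maximalTime {N : ℕ} (α : ℝ) (lam : ℂ) (φ : C₀(Space N, ℂ)) : ℝ≥0∞ :=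
  sSup {T : ℝ≥0∞ | ∃ u : ℝ → C₀(Space N, ℂ), IsSolutionOn α lam φ T u}

/-- A function in `C₀(ℝ^N)` regarded as a tempered distribution `g ↦ ∫ g f`. -/
def toDistribution {N : ℕ} (f : C₀(Space N, ℂ)) : 𝓢'(Space N, ℂ) :=
  ((f.toBCF.memLp_top (μ := volume)).toLp f.toBCF : Lp ℂ ∞ (volume : Measure (Space N)))

/-- `f ∈ H^s(ℝ^N)`, i.e. `𝓕⁻¹ (1 + |ξ|²)^(s/2) 𝓕 f ∈ L²`. -/
def MemHs {N : ℕ} (s : ℝ) (f : C₀(Space N, ℂ)) : Prop :=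
  MemSobolev s 2 (toDistribution f)

/-- The norm `‖f‖_{H^s} = ‖𝓕⁻¹ (1 + |ξ|²)^(s/2) 𝓕 f‖_{L²}`, with value `∞` if `f ∉ H^s(ℝ^N)`.
(The infimum is over the at most one function `g ∈ L²` that represents the distribution
`𝓕⁻¹ (1 + |ξ|²)^(s/2) 𝓕 f`.) -/
def hsNorm {N : ℕ} (s : ℝ) (f : C₀(Space N, ℂ)) : ℝ≥0∞ :=
  ⨅ (g : Lp ℂ 2 (volume : Measure (Space N)))
    (_ : besselPotential (Space N) ℂ s (toDistribution f) = (g : 𝓢'(Space N, ℂ))), ‖g‖ₑ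

/-- Local well-posedness for small data in `H^s(ℝ^N)`: there are `δ, T > 0` such that for every
`φ ∈ C_c^∞(ℝ^N)` with `‖φ‖_{H^s} ≤ δ` the maximal existence time is at least `T` and the
corresponding maximal solution in `C([0, Tmax), C₀(ℝ^N))` satisfies `u(t) ∈ H^s(ℝ^N)` for all
`0 ≤ t ≤ T`. (At `t = T` this is only required when `T < Tmax`, so that `u(T)` makes sense;
dividing `T` by two shows that this makes no difference.) -/
def LocallyWellPosedSmallData (N : ℕ) (s α : ℝ) (lam : ℂ) : Prop :=
  ∃ δ T : ℝ, 0 < δ ∧ 0 < T ∧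
    ∀ φ : C₀(Space N, ℂ), ContDiff ℝ ∞ (φ : Space N → ℂ) →
      HasCompactSupport (φ : Space N → ℂ) → hsNorm s φ ≤ ENNReal.ofReal δ →
        ENNReal.ofReal T ≤ maximalTime α lam φ ∧
        ∀ u : ℝ → C₀(Space N, ℂ), IsSolutionOn α lam φ (maximalTime α lam φ) u →
          ∀ t : ℝ, 0 ≤ t → t ≤ T → ENNReal.ofReal t < maximalTime α lam φ → MemHs s (u t)

end NLHeat

end

/-!
Different mechanisms are at work in two ranges of `s`, which overlap if `N > 7 + 2 α + 4 / α`.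

For `s < N / 2 - 2 / α`, the data `A μ^(2/α) b(μ x)`, with `b` a bump function, are small in `H^s`
for large `μ`. By Jensen's inequality for the Gaussian average, `e^{(t-σ)Δ} u(σ)` at a point is a
supersolution of the ordinary differential equation `m' = lam m^(1+α)`, so that for large `A` the
solution does not survive beyond time `μ⁻²`.

For `s > α + 7 / 2`, take data that are odd in `xᵢ` and equal to `κ xᵢ` near `0`. The solution
remains odd, so that near `0` the nonlinearity keeps the shape `|xᵢ|^α xᵢ` of a function that is
not smooth across the hyperplane `xᵢ = 0`. A fourth difference at scale `ε`, thin in the direction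
`xᵢ`, detects it at order `ε^(2+α)` in the equation satisfied by the solution in the sense of
distributions, whereas `u(t) ∈ H^s` with a bound on the norm that is uniform in a time interval
makes the linear terms smaller. Membership in `H^s` at every time provides such an interval by
Baire's theorem.
-/

open FourierTransform Laplacian ProbabilityTheory

noncomputable section

namespace NLHeat

variable {N : ℕ}

/-! ### The heat semigroup as a Gaussian average -/

theorem heatKernel_pos {t : ℝ} (ht : 0 < t) (x : Space N) : 0 < heatKernel t x := by
  unfold heatKernel
  positivity

theorem ofReal_heatKernel_mul_cexp {t : ℝ} (ht : 0 < t) (x ξ : Space N) :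
    (heatKernel t x : ℂ) * Complex.exp (inner ℝ x ξ * Complex.I)
      = ((4 * Real.pi * t : ℝ) : ℂ) ^ (-(N : ℂ) / 2) *
        Complex.exp (-((4 * t)⁻¹ : ℝ) * ‖x‖ ^ 2 + Complex.I * inner ℝ ξ x) := by
  rw [heatKernel, Complex.exp_add, Complex.ofReal_mul, Complex.ofReal_cpow (by positivity),
    real_inner_comm, mul_comm Complex.I, mul_assoc]
  push_cast
  congr 3
  ring_nf

theorem integrable_heatKernel {t : ℝ} (ht : 0 < t) : Integrable (heatKernel t : Space N → ℝ) := by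
  have hb : 0 < (((4 * t)⁻¹ : ℝ) : ℂ).re := by rw [Complex.ofReal_re]; positivity
  refine (((GaussianFourier.integrable_cexp_neg_mul_sq_norm_add hb Complex.I
    (0 : Space N)).const_mul (((4 * Real.pi * t : ℝ) : ℂ) ^ (-(N : ℂ) / 2))).re).congr ?_
  refine .of_forall fun x ↦ ?_
  simp only [← ofReal_heatKernel_mul_cexp ht]
  simp

theorem integral_heatKernel_mul_cexp {t : ℝ} (ht : 0 < t) (ξ : Space N) :
    ∫ x, (heatKernel t x : ℂ) * Complex.exp (inner ℝ x ξ * Complex.I)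
      = Complex.exp (-(t * ‖ξ‖ ^ 2)) := by
  have hb : 0 < (((4 * t)⁻¹ : ℝ) : ℂ).re := by rw [Complex.ofReal_re]; positivity
  have ht' : (t : ℂ) ≠ 0 := by exact_mod_cast ht.ne'
  have hbase : (Real.pi : ℂ) / ((4 * t)⁻¹ : ℝ) = ((4 * Real.pi * t : ℝ) : ℂ) := by
    push_cast
    field_simp
  have hbase_ne : ((4 * Real.pi * t : ℝ) : ℂ) ≠ 0 := by
    exact_mod_cast (by positivity : 4 * Real.pi * t ≠ 0)
  simp_rw [ofReal_heatKernel_mul_cexp ht]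
  rw [integral_const_mul, GaussianFourier.integral_cexp_neg_mul_sq_norm_add hb,
    finrank_euclideanSpace_fin, hbase, ← mul_assoc, ← Complex.cpow_add _ _ hbase_ne, neg_div,
    neg_add_cancel, Complex.cpow_zero, one_mul, Complex.I_sq]
  push_cast
  congr 1
  field_simp

theorem charFun_map_sqrt_smul_stdGaussian {t : ℝ} (ht : 0 ≤ t) (ξ : Space N) :
    charFun ((stdGaussian (Space N)).map (√(2 * t) • ·)) ξ = Complex.exp (-(t * ‖ξ‖ ^ 2)) := by
  have hnorm : ‖√(2 * t) • ξ‖ ^ 2 = 2 * t * ‖ξ‖ ^ 2 := by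
    rw [norm_smul, mul_pow, Real.norm_of_nonneg (Real.sqrt_nonneg _), Real.sq_sqrt (by positivity)]
  rw [charFun_map_smul, charFun_stdGaussian, ← Complex.ofReal_pow, hnorm]
  push_cast
  ring_nf

theorem withDensity_heatKernel {t : ℝ} (ht : 0 < t) :
    (volume : Measure (Space N)).withDensity (fun x ↦ ENNReal.ofReal (heatKernel t x))
      = (stdGaussian (Space N)).map (√(2 * t) • ·) := by
  have hmeas : Measurable (heatKernel t : Space N → ℝ) := by unfold heatKernel; fun_prop
  have : IsFiniteMeasure ((volume : Measure (Space N)).withDensity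
      fun x ↦ ENNReal.ofReal (heatKernel t x)) :=
    isFiniteMeasure_withDensity_ofReal (integrable_heatKernel ht).2
  refine Measure.ext_of_charFun (funext fun ξ ↦ ?_)
  rw [charFun_map_sqrt_smul_stdGaussian ht.le, charFun_apply,
    integral_withDensity_eq_integral_toReal_smul (by fun_prop) (.of_forall fun x ↦ by simp)]
  simp_rw [ENNReal.toReal_ofReal (heatKernel_pos ht _).le, Complex.real_smul]
  exact integral_heatKernel_mul_cexp ht ξ

theorem heatSemigroup_eq_integral_stdGaussian (t : ℝ) (f : Space N → ℂ) (x : Space N) :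
    heatSemigroup t f x = ∫ z, f (x - √(2 * t) • z) ∂stdGaussian (Space N) := by
  by_cases ht : 0 < t
  · have hmeas : Measurable (heatKernel t : Space N → ℝ) := by unfold heatKernel; fun_prop
    have hemb : MeasurableEmbedding (√(2 * t) • · : Space N → Space N) :=
      (Homeomorph.smulOfNeZero (√(2 * t)) (by positivity)).measurableEmbedding
    calc heatSemigroup t f x = ∫ y, (heatKernel t (x - y) : ℂ) * f y := if_pos ht
      _ = ∫ y, (heatKernel t y : ℂ) * f (x - y) := by
        rw [← integral_sub_left_eq_self _ volume x]
        simp only [sub_sub_cancel]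
      _ = ∫ y, f (x - y) ∂(volume.withDensity fun y ↦ ENNReal.ofReal (heatKernel t y)) := by
        rw [integral_withDensity_eq_integral_toReal_smul (by fun_prop) (.of_forall fun x ↦ by simp)]
        simp_rw [ENNReal.toReal_ofReal (heatKernel_pos ht _).le, Complex.real_smul]
      _ = ∫ z, f (x - √(2 * t) • z) ∂stdGaussian (Space N) := by
        rw [withDensity_heatKernel ht, hemb.integral_map]
  · have h0 : √(2 * t) = 0 := Real.sqrt_eq_zero_of_nonpos (by linarith)
    simp [heatSemigroup, ht, h0]

theorem heatSemigroup_zero (f : Space N → ℂ) : heatSemigroup 0 f = f := by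
  ext x
  simp [heatSemigroup]

theorem norm_heatSemigroup_le (t : ℝ) {f : Space N → ℂ} {M : ℝ} (hf : ∀ y, ‖f y‖ ≤ M)
    (x : Space N) : ‖heatSemigroup t f x‖ ≤ M := by
  rw [heatSemigroup_eq_integral_stdGaussian]
  simpa using norm_integral_le_of_norm_le_const (μ := stdGaussian (Space N))
    (.of_forall fun z ↦ hf (x - √(2 * t) • z))

theorem integrable_comp_sub_smul_stdGaussian {f : Space N → ℂ} (hf : Continuous f) {M : ℝ}
    (hM : ∀ y, ‖f y‖ ≤ M) (x : Space N) (r : ℝ) :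
    Integrable (fun z ↦ f (x - r • z)) (stdGaussian (Space N)) :=
  .of_bound (by fun_prop) M (.of_forall fun _ ↦ hM _)

theorem heatSemigroup_sub (t : ℝ) {f g : Space N → ℂ} (hf : Continuous f) (hg : Continuous g)
    {A B : ℝ} (hA : ∀ y, ‖f y‖ ≤ A) (hB : ∀ y, ‖g y‖ ≤ B) (x : Space N) :
    heatSemigroup t (fun y ↦ f y - g y) x = heatSemigroup t f x - heatSemigroup t g x := by
  simp only [heatSemigroup_eq_integral_stdGaussian]
  exact integral_sub (integrable_comp_sub_smul_stdGaussian hf hA _ _)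
    (integrable_comp_sub_smul_stdGaussian hg hB _ _)

theorem heatSemigroup_neg (t : ℝ) (f : Space N → ℂ) (x : Space N) :
    heatSemigroup t (fun y ↦ -f y) x = -heatSemigroup t f x := by
  simp only [heatSemigroup_eq_integral_stdGaussian, integral_neg]

theorem heatSemigroup_comp_add (t : ℝ) (f : Space N → ℂ) (k x : Space N) :
    heatSemigroup t (fun y ↦ f (y + k)) x = heatSemigroup t f (x + k) := by
  simp only [heatSemigroup_eq_integral_stdGaussian, sub_add_eq_add_sub]

theorem heatSemigroup_comp_isometry (t : ℝ) (f : Space N → ℂ) (L : Space N ≃ₗᵢ[ℝ] Space N)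
    (x : Space N) : heatSemigroup t (fun y ↦ f (L y)) x = heatSemigroup t f (L x) := by
  have hemb : MeasurableEmbedding L := L.toHomeomorph.measurableEmbedding
  simp only [heatSemigroup_eq_integral_stdGaussian, map_sub, map_smul]
  conv_rhs => rw [← stdGaussian_map L, hemb.integral_map fun z ↦ f (L x - √(2 * t) • z)]

theorem continuous_heatSemigroup {X : Type*} [TopologicalSpace X] [FirstCountableTopology X]
    {F : X → Space N → ℂ} (hF : Continuous fun p : X × Space N ↦ F p.1 p.2)
    {M : ℝ} (hM : ∀ p y, ‖F p y‖ ≤ M) {τ : X → ℝ} (hτ : Continuous τ)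
    {y : X → Space N} (hy : Continuous y) :
    Continuous fun p ↦ heatSemigroup (τ p) (F p) (y p) := by
  simp only [heatSemigroup_eq_integral_stdGaussian]
  refine continuous_of_dominated (bound := fun _ ↦ M) (fun p ↦ ?_)
    (fun p ↦ .of_forall fun z ↦ hM _ _) (integrable_const M) (.of_forall fun z ↦ ?_)
  · exact (hF.comp (f := fun z ↦ (p, y p - √(2 * τ p) • z)) (by fun_prop)).aestronglyMeasurable
  · exact hF.comp (f := fun p ↦ (p, y p - √(2 * τ p) • z)) (by fun_prop)

theorem apply_heatSemigroup_le (ℓ : ℂ →L[ℝ] ℝ) (t : ℝ) {f : Space N → ℂ} (hf : Continuous f)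
    {M : ℝ} (hM : ∀ y, ‖f y‖ ≤ M) {D : ℝ} (hD : ∀ y, ℓ (f y) ≤ D) (x : Space N) :
    ℓ (heatSemigroup t f x) ≤ D := by
  have hint := integrable_comp_sub_smul_stdGaussian hf hM x √(2 * t)
  rw [heatSemigroup_eq_integral_stdGaussian, ← ℓ.integral_comp_comm hint]
  simpa using integral_mono (ℓ.integrable_comp hint) (integrable_const D) fun z ↦ hD _

theorem map_conv_stdGaussian {s t : ℝ} (hs : 0 ≤ s) (ht : 0 ≤ t) :
    ((stdGaussian (Space N)).map (√(2 * s) • ·)).conv ((stdGaussian (Space N)).map (√(2 * t) • ·))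
      = (stdGaussian (Space N)).map (√(2 * (s + t)) • ·) := by
  refine Measure.ext_of_charFun (funext fun ξ ↦ ?_)
  rw [charFun_conv, charFun_map_sqrt_smul_stdGaussian hs, charFun_map_sqrt_smul_stdGaussian ht,
    charFun_map_sqrt_smul_stdGaussian (by positivity), ← Complex.exp_add]
  push_cast
  ring_nf

theorem heatSemigroup_heatSemigroup {s t : ℝ} (hs : 0 ≤ s) (ht : 0 ≤ t) {f : Space N → ℂ}
    (hf : Continuous f) {M : ℝ} (hM : ∀ y, ‖f y‖ ≤ M) (x : Space N) :
    heatSemigroup s (heatSemigroup t f) x = heatSemigroup (s + t) f x := by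
  have hint (μ : Measure (Space N)) [IsFiniteMeasure μ] : Integrable (fun y ↦ f (x - y)) μ :=
    .of_bound (by fun_prop) M (.of_forall fun _ ↦ hM _)
  have _ (r : ℝ) : IsProbabilityMeasure ((stdGaussian (Space N)).map (r • ·)) :=
    Measure.isProbabilityMeasure_map (by fun_prop)
  have havg (r : ℝ) (g : Space N → ℂ) (hg : Continuous g) (y : Space N) :
      heatSemigroup r g y = ∫ z, g (y - z) ∂(stdGaussian (Space N)).map (√(2 * r) • ·) := by
    rw [heatSemigroup_eq_integral_stdGaussian, integral_map (by fun_prop) (by fun_prop)]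
  rw [havg _ f hf, ← map_conv_stdGaussian hs ht, integral_conv (hint _), havg]
  · simp only [havg t f hf, sub_sub]
  · exact continuous_heatSemigroup (F := fun _ ↦ f) (hf.comp continuous_snd) (fun _ ↦ hM)
      continuous_const continuous_id

/-! ### The heat semigroup against Schwartz functions -/

theorem integrable_mul_schwartz {f : Space N → ℂ} (hf : Continuous f) {M : ℝ}
    (hM : ∀ x, ‖f x‖ ≤ M) (h : 𝓢(Space N, ℂ)) : Integrable fun x ↦ f x * h x :=
  h.integrable.bdd_mul hf.aestronglyMeasurable (.of_forall hM)

theorem continuous_integral_mul_schwartz {X : Type*} [TopologicalSpace X]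
    [FirstCountableTopology X] {F : X → Space N → ℂ}
    (hF : Continuous fun p : X × Space N ↦ F p.1 p.2) {M : ℝ} (hM : ∀ p x, ‖F p x‖ ≤ M)
    (h : 𝓢(Space N, ℂ)) : Continuous fun p ↦ ∫ x, F p x * h x := by
  refine continuous_of_dominated (bound := fun x ↦ M * ‖h x‖) (fun p ↦ ?_)
    (fun p ↦ .of_forall fun x ↦ ?_) (h.integrable.norm.const_mul M) (.of_forall fun x ↦ ?_)
  · exact ((hF.comp (f := fun x ↦ (p, x)) (by fun_prop)).mul h.continuous).aestronglyMeasurable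
  · rw [norm_mul]
    exact mul_le_mul_of_nonneg_right (hM p x) (norm_nonneg _)
  · exact (hF.comp (f := fun p ↦ (p, x)) (by fun_prop)).mul continuous_const

theorem integrable_comp_sub_smul_prod {h : Space N → ℂ} (hc : Continuous h) (hh : Integrable h)
    (r : ℝ) : Integrable (fun p : Space N × Space N ↦ h (p.1 - r • p.2))
      (volume.prod (stdGaussian (Space N))) := by
  refine (integrable_prod_iff' (by fun_prop)).2 ⟨.of_forall fun z ↦ ?_, ?_⟩
  · exact hh.comp_sub_right (r • z)
  · simp only [integral_sub_right_eq_self fun x ↦ ‖h x‖, integrable_const]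

theorem integrable_heatSemigroup (t : ℝ) {h : Space N → ℂ} (hc : Continuous h)
    (hh : Integrable h) : Integrable (heatSemigroup t h : Space N → ℂ) := by
  have := (integrable_comp_sub_smul_prod hc hh √(2 * t)).integral_prod_left
  exact this.congr (.of_forall fun x ↦ (heatSemigroup_eq_integral_stdGaussian t h x).symm)

theorem integral_norm_heatSemigroup_le (t : ℝ) {h : Space N → ℂ} (hc : Continuous h)
    (hh : Integrable h) : ∫ x, ‖heatSemigroup t h x‖ ≤ ∫ x, ‖h x‖ := by
  have hint := (integrable_comp_sub_smul_prod hc hh √(2 * t)).norm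
  calc ∫ x, ‖heatSemigroup t h x‖
      ≤ ∫ x, ∫ z, ‖h (x - √(2 * t) • z)‖ ∂stdGaussian (Space N) := by
        refine integral_mono (integrable_heatSemigroup t hc hh).norm hint.integral_prod_left
          fun x ↦ ?_
        simp only [heatSemigroup_eq_integral_stdGaussian]
        exact norm_integral_le_integral_norm _
    _ = ∫ z, (∫ x, ‖h (x - √(2 * t) • z)‖) ∂stdGaussian (Space N) := integral_integral_swap hint
    _ = ∫ x, ‖h x‖ := by simp only [integral_sub_right_eq_self fun x ↦ ‖h x‖]; simp

theorem integral_comp_neg_stdGaussian (f : Space N → ℂ) :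
    ∫ z, f (-z) ∂stdGaussian (Space N) = ∫ z, f z ∂stdGaussian (Space N) := by
  have hemb : MeasurableEmbedding (LinearIsometryEquiv.neg ℝ : Space N ≃ₗᵢ[ℝ] Space N) :=
    (LinearIsometryEquiv.neg ℝ).toHomeomorph.measurableEmbedding
  conv_rhs => rw [← stdGaussian_map (LinearIsometryEquiv.neg ℝ), hemb.integral_map]
  rfl

theorem integral_heatSemigroup_mul (t : ℝ) {f h : Space N → ℂ} (hf : Continuous f) {M : ℝ}
    (hM : ∀ y, ‖f y‖ ≤ M) (hc : Continuous h) (hh : Integrable h) :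
    ∫ x, heatSemigroup t f x * h x = ∫ x, f x * heatSemigroup t h x := by
  have hfwd : Integrable (fun p : Space N × Space N ↦ f (p.1 - √(2 * t) • p.2) * h p.1)
      (volume.prod (stdGaussian (Space N))) :=
    (hh.comp_fst _).bdd_mul (by fun_prop) (.of_forall fun _ ↦ hM _)
  have hbwd : Integrable (fun p : Space N × Space N ↦ f p.1 * h (p.1 - √(2 * t) • p.2))
      (volume.prod (stdGaussian (Space N))) :=
    (integrable_comp_sub_smul_prod hc hh _).bdd_mul (by fun_prop) (.of_forall fun _ ↦ hM _)
  simp only [heatSemigroup_eq_integral_stdGaussian, ← integral_mul_const, ← integral_const_mul]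
  calc ∫ x, ∫ z, f (x - √(2 * t) • z) * h x ∂stdGaussian (Space N)
      = ∫ z, (∫ x, f (x - √(2 * t) • z) * h x) ∂stdGaussian (Space N) :=
        integral_integral_swap hfwd
    _ = ∫ z, (∫ x, f x * h (x - √(2 * t) • -z)) ∂stdGaussian (Space N) := by
        congr 1 with z
        rw [← integral_add_right_eq_self _ (√(2 * t) • z)]
        simp
    _ = ∫ z, (∫ x, f x * h (x - √(2 * t) • z)) ∂stdGaussian (Space N) :=
        integral_comp_neg_stdGaussian fun z ↦ ∫ x, f x * h (x - √(2 * t) • z)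
    _ = ∫ x, ∫ z, f x * h (x - √(2 * t) • z) ∂stdGaussian (Space N) :=
        (integral_integral_swap hbwd).symm

/-- The evolution `exp (r Δ)` of the plane wave `exp (2 π i ⟨ξ, x⟩)`. -/
def heatWave (r : ℝ) (x ξ : Space N) : ℂ :=
  Complex.exp (-((2 * Real.pi) ^ 2 * ‖ξ‖ ^ 2 : ℝ) * r + (2 * Real.pi * inner ℝ ξ x : ℝ) * Complex.I)

theorem continuous_heatWave (x : Space N) :
    Continuous fun p : ℝ × Space N ↦ heatWave p.1 x p.2 := by
  unfold heatWave
  fun_prop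

theorem norm_heatWave_le {r : ℝ} (hr : 0 ≤ r) (x ξ : Space N) : ‖heatWave r x ξ‖ ≤ 1 := by
  rw [heatWave, Complex.exp_add, norm_mul, Complex.norm_exp_ofReal_mul_I, mul_one,
    ← Complex.ofReal_neg, ← Complex.ofReal_mul, Complex.norm_exp, Complex.ofReal_re,
    Real.exp_le_one_iff, neg_mul]
  exact neg_nonpos.2 (by positivity)

theorem heatWave_sub_heatWave_zero (t : ℝ) (x ξ : Space N) : heatWave t x ξ - heatWave 0 x ξ
    = (∫ r in (0 : ℝ)..t, heatWave r x ξ) * -((2 * Real.pi) ^ 2 * ‖ξ‖ ^ 2 : ℝ) := by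
  have hderiv (r : ℝ) : HasDerivAt (fun r ↦ heatWave r x ξ)
      (heatWave r x ξ * -((2 * Real.pi) ^ 2 * ‖ξ‖ ^ 2 : ℝ)) r := by
    have hexp := ((hasDerivAt_mul_const (-((2 * Real.pi) ^ 2 * ‖ξ‖ ^ 2 : ℝ) : ℂ)).comp_ofReal
      (z := r)).add_const ((2 * Real.pi * inner ℝ ξ x : ℝ) * Complex.I)
    simpa only [heatWave, mul_comm] using hexp.cexp
  have hcont : Continuous fun r ↦ heatWave r x ξ :=
    (continuous_heatWave x).comp (f := fun r : ℝ ↦ (r, ξ)) (by fun_prop)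
  rw [← intervalIntegral.integral_mul_const, intervalIntegral.integral_eq_sub_of_hasDerivAt
    (fun r _ ↦ hderiv r) ((hcont.mul continuous_const).intervalIntegrable _ _)]

theorem integral_cexp_inner_stdGaussian {t : ℝ} (ht : 0 ≤ t) (x ξ : Space N) :
    ∫ z, Complex.exp ((2 * Real.pi * inner ℝ ξ (x - √(2 * t) • z) : ℝ) * Complex.I)
      ∂stdGaussian (Space N) = heatWave t x ξ := by
  have hchar := charFun_map_sqrt_smul_stdGaussian ht (-(2 * Real.pi) • ξ)
  rw [charFun_apply, integral_map (by fun_prop) (by fun_prop)] at hchar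
  rw [norm_smul, Real.norm_eq_abs, abs_neg, abs_of_nonneg (by positivity)] at hchar
  calc _ = ∫ z, Complex.exp ((2 * Real.pi * inner ℝ ξ x : ℝ) * Complex.I) *
        Complex.exp (inner ℝ (√(2 * t) • z) (-(2 * Real.pi) • ξ) * Complex.I)
        ∂stdGaussian (Space N) := by
        congr 1 with z
        rw [← Complex.exp_add, ← add_mul, ← Complex.ofReal_add, inner_smul_right, inner_sub_right,
          real_inner_comm ξ]
        ring_nf
    _ = heatWave t x ξ := by
        rw [integral_const_mul, hchar, heatWave, ← Complex.exp_add]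
        push_cast
        ring_nf

theorem heatSemigroup_eq_integral_fourier (h : 𝓢(Space N, ℂ)) {t : ℝ} (ht : 0 ≤ t)
    (x : Space N) : heatSemigroup t h x = ∫ ξ, heatWave t x ξ * 𝓕 h ξ := by
  have hinv (y : Space N) : h y
      = ∫ ξ, Complex.exp ((2 * Real.pi * inner ℝ ξ y : ℝ) * Complex.I) * 𝓕 h ξ := by
    conv_lhs => rw [← FourierTransform.fourierInv_fourier_eq (F := 𝓢(Space N, ℂ)) h,
      SchwartzMap.fourierInv_coe, Real.fourierInv_eq']
    rfl
  have hint : Integrable (fun p : Space N × Space N ↦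
      Complex.exp ((2 * Real.pi * inner ℝ p.2 (x - √(2 * t) • p.1) : ℝ) * Complex.I) * 𝓕 h p.2)
      ((stdGaussian (Space N)).prod volume) :=
    ((𝓕 h).integrable.comp_snd _).bdd_mul (c := 1) (by fun_prop)
      (.of_forall fun p ↦ (Complex.norm_exp_ofReal_mul_I _).le)
  rw [heatSemigroup_eq_integral_stdGaussian]
  simp_rw [hinv (x - √(2 * t) • _)]
  rw [integral_integral_swap hint]
  simp only [integral_mul_const, integral_cexp_inner_stdGaussian ht]

theorem fourier_laplacian (h : 𝓢(Space N, ℂ)) (ξ : Space N) :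
    𝓕 (Δ h : 𝓢(Space N, ℂ)) ξ = -((2 * Real.pi) ^ 2 * ‖ξ‖ ^ 2 : ℝ) * 𝓕 h ξ := by
  rw [SchwartzMap.laplacian_eq_fourierMultiplierCLM, SchwartzMap.fourierMultiplierCLM_apply,
    FourierTransform.fourier_smul, FourierTransform.fourier_fourierInv_eq, _root_.smul_apply,
    SchwartzMap.smulLeftCLM_apply_apply (by fun_prop)]
  simp only [Complex.real_smul, Complex.ofReal_pow, neg_smul, Complex.ofReal_mul,
    Complex.ofReal_ofNat, neg_mul, neg_inj]
  ring

theorem heatSemigroup_sub_self (h : 𝓢(Space N, ℂ)) {t : ℝ} (ht : 0 ≤ t) (x : Space N) :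
    heatSemigroup t h x - h x
      = ∫ r in (0 : ℝ)..t, heatSemigroup r (Δ h : 𝓢(Space N, ℂ)) x := by
  have hcont (r : ℝ) : Continuous (heatWave r x) :=
    (continuous_heatWave x).comp (f := fun ξ ↦ (r, ξ)) (by fun_prop)
  have hint (r : ℝ) (hr : 0 ≤ r) (g : 𝓢(Space N, ℂ)) : Integrable fun ξ ↦ heatWave r x ξ * g ξ :=
    integrable_mul_schwartz (hcont r) (norm_heatWave_le hr x) g
  have hprod : Integrable
      (Function.uncurry fun r ξ ↦ heatWave r x ξ * 𝓕 (Δ h : 𝓢(Space N, ℂ)) ξ)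
      ((volume.restrict (uIoc 0 t)).prod volume) := by
    rw [uIoc_of_le ht]
    refine Integrable.bdd_mul (c := 1) ((𝓕 (Δ h : 𝓢(Space N, ℂ))).integrable.comp_snd _)
      (continuous_heatWave x).aestronglyMeasurable ?_
    have hmem : ∀ᵐ r ∂volume.restrict (Ioc 0 t), r ∈ Ioc 0 t := ae_restrict_mem measurableSet_Ioc
    filter_upwards [Measure.quasiMeasurePreserving_fst.ae hmem] with p hp
    exact norm_heatWave_le hp.1.le x _
  calc heatSemigroup t h x - h x
      = ∫ ξ, (heatWave t x ξ * 𝓕 h ξ - heatWave 0 x ξ * 𝓕 h ξ) := by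
        rw [integral_sub (hint t ht _) (hint 0 le_rfl _), ← heatSemigroup_eq_integral_fourier h ht,
          ← heatSemigroup_eq_integral_fourier h le_rfl, heatSemigroup_zero]
    _ = ∫ ξ, ∫ r in (0 : ℝ)..t, heatWave r x ξ * 𝓕 (Δ h : 𝓢(Space N, ℂ)) ξ := by
        congr 1 with ξ
        rw [← sub_mul, heatWave_sub_heatWave_zero, fourier_laplacian,
          intervalIntegral.integral_mul_const, mul_assoc]
    _ = ∫ r in (0 : ℝ)..t, ∫ ξ, heatWave r x ξ * 𝓕 (Δ h : 𝓢(Space N, ℂ)) ξ :=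
        (intervalIntegral_integral_swap hprod).symm
    _ = ∫ r in (0 : ℝ)..t, heatSemigroup r (Δ h : 𝓢(Space N, ℂ)) x := by
        refine intervalIntegral.integral_congr fun r hr ↦ ?_
        rw [uIcc_of_le ht] at hr
        exact (heatSemigroup_eq_integral_fourier _ hr.1 x).symm

/-! ### Duhamel integrals -/

/-- The Duhamel integral `∫₀ᵗ e^{(t-σ)Δ} g(σ) dσ`, the solution of `∂ₜ w = Δ w + g` with
`w(0) = 0`. -/
def duhamel (g : ℝ → Space N → ℂ) (t : ℝ) (x : Space N) : ℂ :=
  ∫ σ in (0 : ℝ)..t, heatSemigroup (t - σ) (g σ) x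

theorem duhamel_neg (g : ℝ → Space N → ℂ) (t : ℝ) (x : Space N) :
    duhamel (fun σ y ↦ -g σ y) t x = -duhamel g t x := by
  simp only [duhamel, heatSemigroup_neg, intervalIntegral.integral_neg]

theorem duhamel_comp_add (g : ℝ → Space N → ℂ) (t : ℝ) (k x : Space N) :
    duhamel (fun σ y ↦ g σ (y + k)) t x = duhamel g t (x + k) := by
  simp only [duhamel, heatSemigroup_comp_add]

theorem duhamel_comp_isometry (g : ℝ → Space N → ℂ) (L : Space N ≃ₗᵢ[ℝ] Space N) (t : ℝ)
    (x : Space N) : duhamel (fun σ y ↦ g σ (L y)) t x = duhamel g t (L x) := by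
  simp only [duhamel, heatSemigroup_comp_isometry]

section Continuous

variable {g g' : ℝ → Space N → ℂ} {C C' : ℝ}

theorem continuous_heatSemigroup_apply (hg : Continuous fun p : ℝ × Space N ↦ g p.1 p.2)
    (hC : ∀ σ y, ‖g σ y‖ ≤ C) :
    Continuous fun p : ℝ × ℝ × Space N ↦ heatSemigroup p.1 (g p.2.1) p.2.2 :=
  continuous_heatSemigroup (F := fun p : ℝ × ℝ × Space N ↦ g p.2.1)
    (hg.comp (f := fun p : (ℝ × ℝ × Space N) × Space N ↦ (p.1.2.1, p.2)) (by fun_prop))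
    (fun _ ↦ hC _) (by fun_prop) (by fun_prop)

theorem continuous_duhamel (hg : Continuous fun p : ℝ × Space N ↦ g p.1 p.2)
    (hC : ∀ σ y, ‖g σ y‖ ≤ C) : Continuous fun p : ℝ × Space N ↦ duhamel g p.1 p.2 :=
  intervalIntegral.continuous_parametric_intervalIntegral_of_continuous
    (f := fun (p : ℝ × Space N) σ ↦ heatSemigroup (p.1 - σ) (g σ) p.2)
    ((continuous_heatSemigroup_apply hg hC).comp
      (f := fun q : (ℝ × Space N) × ℝ ↦ (q.1.1 - q.2, q.2, q.1.2)) (by fun_prop)) continuous_fst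

theorem continuous_duhamel_integrand (hg : Continuous fun p : ℝ × Space N ↦ g p.1 p.2)
    (hC : ∀ σ y, ‖g σ y‖ ≤ C) (t : ℝ) (x : Space N) :
    Continuous fun σ ↦ heatSemigroup (t - σ) (g σ) x :=
  (continuous_heatSemigroup_apply hg hC).comp (f := fun σ ↦ (t - σ, σ, x)) (by fun_prop)

theorem duhamel_sub (hg : Continuous fun p : ℝ × Space N ↦ g p.1 p.2) (hC : ∀ σ y, ‖g σ y‖ ≤ C)
    (hg' : Continuous fun p : ℝ × Space N ↦ g' p.1 p.2) (hC' : ∀ σ y, ‖g' σ y‖ ≤ C') (t : ℝ)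
    (x : Space N) :
    duhamel (fun σ y ↦ g σ y - g' σ y) t x = duhamel g t x - duhamel g' t x := by
  unfold duhamel
  rw [← intervalIntegral.integral_sub
    ((continuous_duhamel_integrand hg hC t x).intervalIntegrable _ _)
    ((continuous_duhamel_integrand hg' hC' t x).intervalIntegrable _ _)]
  congr 1 with σ
  exact heatSemigroup_sub _ (hg.uncurry_left σ) (hg'.uncurry_left σ) (hC σ) (hC' σ) x

theorem norm_duhamel_le_integral {b : ℝ → ℝ} (hb : Continuous b) {t : ℝ} (ht : 0 ≤ t)
    (h : ∀ σ ∈ Icc 0 t, ∀ y, ‖g σ y‖ ≤ b σ) (x : Space N) :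
    ‖duhamel g t x‖ ≤ ∫ σ in (0 : ℝ)..t, b σ :=
  intervalIntegral.norm_integral_le_of_norm_le ht
    (.of_forall fun σ hσ ↦ norm_heatSemigroup_le _ (h σ ⟨hσ.1.le, hσ.2⟩) x)
    (hb.intervalIntegrable _ _)

theorem norm_duhamel_le {t : ℝ} (ht : 0 ≤ t) (h : ∀ σ ∈ Icc 0 t, ∀ y, ‖g σ y‖ ≤ C)
    (x : Space N) : ‖duhamel g t x‖ ≤ t * C := by
  simpa using norm_duhamel_le_integral continuous_const ht h x

theorem apply_duhamel_le_integral (ℓ : ℂ →L[ℝ] ℝ)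
    (hg : Continuous fun p : ℝ × Space N ↦ g p.1 p.2) (hC : ∀ σ y, ‖g σ y‖ ≤ C)
    {b : ℝ → ℝ} (hb : Continuous b) {t : ℝ} (ht : 0 ≤ t)
    (h : ∀ σ ∈ Icc 0 t, ∀ y, ℓ (g σ y) ≤ b σ) (x : Space N) :
    ℓ (duhamel g t x) ≤ ∫ σ in (0 : ℝ)..t, b σ := by
  have hint := continuous_duhamel_integrand hg hC t x
  rw [duhamel, ← ℓ.intervalIntegral_comp_comm (hint.intervalIntegrable _ _)]
  exact intervalIntegral.integral_mono_on ht ((ℓ.continuous.comp hint).intervalIntegrable _ _)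
    (hb.intervalIntegrable _ _)
    fun σ hσ ↦ apply_heatSemigroup_le ℓ _ (hg.uncurry_left σ) (hC σ) (h σ hσ) x

theorem integral_duhamel_mul (hg : Continuous fun p : ℝ × Space N ↦ g p.1 p.2)
    (hC : ∀ σ y, ‖g σ y‖ ≤ C) (h : 𝓢(Space N, ℂ)) (t : ℝ) :
    ∫ x, duhamel g t x * h x
      = ∫ σ in (0 : ℝ)..t, ∫ x, heatSemigroup (t - σ) (g σ) x * h x := by
  have hcont : Continuous fun p : ℝ × Space N ↦ heatSemigroup (t - p.1) (g p.1) p.2 :=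
    (continuous_heatSemigroup_apply hg hC).comp
      (f := fun p : ℝ × Space N ↦ (t - p.1, p.1, p.2)) (by fun_prop)
  have hprod : Integrable (Function.uncurry fun σ x ↦ heatSemigroup (t - σ) (g σ) x * h x)
      ((volume.restrict (uIoc 0 t)).prod volume) := by
    have : IsFiniteMeasure ((volume : Measure ℝ).restrict (uIoc 0 t)) := by
      rw [uIoc]; infer_instance
    exact (h.integrable.comp_snd _).bdd_mul hcont.aestronglyMeasurable
      (.of_forall fun p ↦ norm_heatSemigroup_le _ (hC p.1) p.2)
  simp only [duhamel, ← intervalIntegral.integral_mul_const]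
  exact (intervalIntegral_integral_swap hprod).symm

end Continuous

/-! ### The heat equation in the sense of distributions -/

theorem intervalIntegral_integral_heatSemigroup_swap {f h : Space N → ℂ} (hf : Continuous f)
    {M : ℝ} (hM : ∀ y, ‖f y‖ ≤ M) (hc : Continuous h) (hh : Integrable h) {B : ℝ}
    (hB : ∀ y, ‖h y‖ ≤ B) {t : ℝ} :
    ∫ r in (0 : ℝ)..t, ∫ x, f x * heatSemigroup r h x
      = ∫ x, ∫ r in (0 : ℝ)..t, f x * heatSemigroup r h x := by
  have hcont : Continuous fun p : ℝ × Space N ↦ f p.2 * heatSemigroup p.1 h p.2 :=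
    (hf.comp continuous_snd).mul (continuous_heatSemigroup (F := fun _ ↦ h)
      (hc.comp continuous_snd) (fun _ ↦ hB) continuous_fst continuous_snd)
  have hmul (r : ℝ) : Integrable fun x ↦ f x * heatSemigroup r h x :=
    (integrable_heatSemigroup r hc hh).bdd_mul hf.aestronglyMeasurable (.of_forall hM)
  have hM₀ : 0 ≤ M := (norm_nonneg _).trans (hM 0)
  have hnorm (r : ℝ) : ∫ x, ‖f x * heatSemigroup r h x‖ ≤ M * ∫ x, ‖h x‖ :=
    calc ∫ x, ‖f x * heatSemigroup r h x‖
        ≤ ∫ x, M * ‖heatSemigroup r h x‖ := by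
          refine integral_mono (hmul r).norm
            ((integrable_heatSemigroup r hc hh).norm.const_mul M) fun x ↦ ?_
          simp only [norm_mul]
          exact mul_le_mul_of_nonneg_right (hM x) (norm_nonneg _)
      _ ≤ M * ∫ x, ‖h x‖ := by
          rw [integral_const_mul]
          exact mul_le_mul_of_nonneg_left (integral_norm_heatSemigroup_le r hc hh) hM₀
  refine intervalIntegral_integral_swap ?_
  have : IsFiniteMeasure ((volume : Measure ℝ).restrict (uIoc 0 t)) := by
    rw [uIoc]; infer_instance
  refine (integrable_prod_iff hcont.aestronglyMeasurable).2 ⟨.of_forall hmul, ?_⟩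
  refine Integrable.mono' (integrable_const (M * ∫ x, ‖h x‖))
    hcont.norm.aestronglyMeasurable.integral_prod_right' (.of_forall fun r ↦ ?_)
  rw [Real.norm_of_nonneg (integral_nonneg fun x ↦ norm_nonneg _)]
  exact hnorm r

theorem integral_heatSemigroup_mul_sub {f : Space N → ℂ} (hf : Continuous f) {M : ℝ}
    (hM : ∀ y, ‖f y‖ ≤ M) (h : 𝓢(Space N, ℂ)) {t : ℝ} (ht : 0 ≤ t) :
    (∫ x, heatSemigroup t f x * h x) - ∫ x, f x * h x
      = ∫ r in (0 : ℝ)..t, ∫ x, heatSemigroup r f x * (Δ h : 𝓢(Space N, ℂ)) x := by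
  have hbdd (k : 𝓢(Space N, ℂ)) (y : Space N) : ‖k y‖ ≤ ‖k.toBoundedContinuousFunction‖ :=
    k.toBoundedContinuousFunction.norm_coe_le_norm y
  simp only [integral_heatSemigroup_mul _ hf hM (SchwartzMap.continuous _)
    (SchwartzMap.integrable _)]
  rw [intervalIntegral_integral_heatSemigroup_swap hf hM (SchwartzMap.continuous _)
    (SchwartzMap.integrable _) (hbdd _), ← integral_sub
    ((integrable_heatSemigroup t h.continuous h.integrable).bdd_mul hf.aestronglyMeasurable
      (.of_forall hM)) (integrable_mul_schwartz hf hM h)]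
  simp only [intervalIntegral.integral_const_mul, ← heatSemigroup_sub_self h ht, mul_sub]

theorem intervalIntegral_triangle_swap {K : ℝ → ℝ → ℂ}
    (hK : Continuous fun p : ℝ × ℝ ↦ K p.1 p.2) {t : ℝ} (ht : 0 ≤ t) :
    ∫ τ in (0 : ℝ)..t, ∫ σ in (0 : ℝ)..τ, K σ τ = ∫ σ in (0 : ℝ)..t, ∫ τ in σ..t, K σ τ := by
  set L : ℝ × ℝ → ℂ := {p : ℝ × ℝ | p.1 ≤ p.2}.indicator fun p ↦ K p.1 p.2 with hL
  have hinner : ∀ τ ∈ Ioc 0 t, ∫ σ in (0 : ℝ)..τ, K σ τ = ∫ σ in Ioc 0 t, L (σ, τ) := by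
    intro τ hτ
    rw [intervalIntegral.integral_of_le hτ.1.le, ← integral_indicator measurableSet_Ioc,
      ← integral_indicator measurableSet_Ioc]
    congr 1 with σ
    simp only [hL, indicator_apply, mem_Ioc, mem_ofPred_eq]
    grind
  have houter : ∀ σ ∈ Ioc 0 t, ∫ τ in σ..t, K σ τ = ∫ τ in Ioc 0 t, L (σ, τ) := by
    intro σ hσ
    rw [intervalIntegral.integral_of_le hσ.2, ← integral_Icc_eq_integral_Ioc,
      ← integral_indicator measurableSet_Icc, ← integral_indicator measurableSet_Ioc]
    congr 1 with τ
    simp only [hL, indicator_apply, mem_Ioc, mem_Icc, mem_ofPred_eq]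
    grind
  rw [intervalIntegral.integral_of_le ht, intervalIntegral.integral_of_le ht,
    setIntegral_congr_fun measurableSet_Ioc hinner, setIntegral_congr_fun measurableSet_Ioc houter]
  refine (integral_integral_swap (f := fun σ τ ↦ L (σ, τ)) ?_).symm
  refine Integrable.indicator ?_ (measurableSet_le measurable_fst measurable_snd)
  rw [Measure.prod_restrict]
  exact (hK.continuousOn.integrableOn_compact (isCompact_Icc.prod isCompact_Icc)).mono_set
    (prod_mono Ioc_subset_Icc_self Ioc_subset_Icc_self)

theorem continuous_integral_heatSemigroup_mul {g : ℝ → Space N → ℂ} {C : ℝ}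
    (hg : Continuous fun p : ℝ × Space N ↦ g p.1 p.2) (hC : ∀ σ y, ‖g σ y‖ ≤ C)
    (h : 𝓢(Space N, ℂ)) :
    Continuous fun p : ℝ × ℝ ↦ ∫ x, heatSemigroup p.1 (g p.2) x * h x :=
  continuous_integral_mul_schwartz (F := fun p : ℝ × ℝ ↦ heatSemigroup p.1 (g p.2))
    ((continuous_heatSemigroup_apply hg hC).comp
      (f := fun p : (ℝ × ℝ) × Space N ↦ (p.1.1, p.1.2, p.2)) (by fun_prop))
    (fun p x ↦ norm_heatSemigroup_le _ (hC p.2) x) h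

theorem continuous_integral_duhamel_mul {g : ℝ → Space N → ℂ} {C : ℝ}
    (hg : Continuous fun p : ℝ × Space N ↦ g p.1 p.2) (hC : ∀ σ y, ‖g σ y‖ ≤ C)
    (h : 𝓢(Space N, ℂ)) : Continuous fun t ↦ ∫ x, duhamel g t x * h x := by
  simp only [integral_duhamel_mul hg hC h]
  exact intervalIntegral.continuous_parametric_intervalIntegral_of_continuous
    (f := fun t σ ↦ ∫ x, heatSemigroup (t - σ) (g σ) x * h x)
    ((continuous_integral_heatSemigroup_mul hg hC h).comp
      (f := fun p : ℝ × ℝ ↦ (p.1 - p.2, p.2)) (by fun_prop)) continuous_id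

theorem integral_duhamel_mul_eq {g : ℝ → Space N → ℂ} {C : ℝ}
    (hg : Continuous fun p : ℝ × Space N ↦ g p.1 p.2) (hC : ∀ σ y, ‖g σ y‖ ≤ C)
    (h : 𝓢(Space N, ℂ)) {t : ℝ} (ht : 0 ≤ t) :
    ∫ x, duhamel g t x * h x
      = (∫ τ in (0 : ℝ)..t, ∫ x, duhamel g τ x * (Δ h : 𝓢(Space N, ℂ)) x)
        + ∫ τ in (0 : ℝ)..t, ∫ x, g τ x * h x := by
  let Q (k : 𝓢(Space N, ℂ)) (r σ : ℝ) : ℂ := ∫ x, heatSemigroup r (g σ) x * k x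
  have hQ (k : 𝓢(Space N, ℂ)) : Continuous fun p : ℝ × ℝ ↦ Q k p.1 p.2 :=
    continuous_integral_heatSemigroup_mul hg hC k
  have hQ₀ (σ : ℝ) : Q h 0 σ = ∫ x, g σ x * h x := by simp only [Q, heatSemigroup_zero]
  have hsub (σ : ℝ) (hσ : σ ∈ uIcc 0 t) :
      ∫ τ in σ..t, Q (Δ h) (τ - σ) σ = Q h (t - σ) σ - Q h 0 σ := by
    rw [uIcc_of_le ht] at hσ
    rw [intervalIntegral.integral_comp_sub_right (fun r ↦ Q (Δ h) r σ) σ, sub_self, hQ₀]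
    exact (integral_heatSemigroup_mul_sub (hg.uncurry_left σ) (hC σ) h (sub_nonneg.2 hσ.2)).symm
  have hswap : ∫ τ in (0 : ℝ)..t, ∫ x, duhamel g τ x * (Δ h : 𝓢(Space N, ℂ)) x
      = (∫ σ in (0 : ℝ)..t, Q h (t - σ) σ) - ∫ σ in (0 : ℝ)..t, Q h 0 σ := by
    simp only [integral_duhamel_mul hg hC]
    rw [intervalIntegral_triangle_swap (K := fun σ τ ↦ Q (Δ h) (τ - σ) σ)
      ((hQ _).comp (f := fun p : ℝ × ℝ ↦ (p.2 - p.1, p.1)) (by fun_prop)) ht,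
      intervalIntegral.integral_congr hsub]
    exact intervalIntegral.integral_sub
      (((hQ h).comp (f := fun σ : ℝ ↦ (t - σ, σ)) (by fun_prop)).intervalIntegrable _ _)
      (((hQ h).comp (f := fun σ : ℝ ↦ (0, σ)) (by fun_prop)).intervalIntegrable _ _)
  rw [hswap, integral_duhamel_mul hg hC h t]
  simp only [hQ₀, sub_add_cancel, Q]

/-! ### The nonlinearity -/

/-- The nonlinearity `|z|^α z`. -/
def powNl (α : ℝ) (z : ℂ) : ℂ := ((‖z‖ ^ α : ℝ) : ℂ) * z

theorem powNl_neg (α : ℝ) (z : ℂ) : powNl α (-z) = -powNl α z := by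
  simp [powNl]

theorem apply_powNl (ℓ : ℂ →L[ℝ] ℝ) (α : ℝ) (z : ℂ) : ℓ (powNl α z) = ‖z‖ ^ α * ℓ z := by
  rw [powNl, ← Complex.real_smul, map_smul, smul_eq_mul]

theorem powNl_ofReal {α r : ℝ} (hα : 0 < α) (hr : 0 ≤ r) :
    powNl α (r : ℂ) = ((r ^ (1 + α) : ℝ) : ℂ) := by
  rw [powNl, Complex.norm_real, Real.norm_of_nonneg hr, ← Complex.ofReal_mul, add_comm,
    Real.rpow_add_one' hr (by positivity)]

theorem norm_powNl_le {α : ℝ} (hα : 0 ≤ α) {M : ℝ} {z : ℂ} (hz : ‖z‖ ≤ M) :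
    ‖powNl α z‖ ≤ M ^ α * M := by
  have hM : 0 ≤ M := (norm_nonneg z).trans hz
  rw [powNl, norm_mul, Complex.norm_real, Real.norm_of_nonneg (by positivity)]
  gcongr

theorem continuous_powNl {α : ℝ} (hα : 0 ≤ α) : Continuous (powNl α) := by
  have : Continuous fun z : ℂ ↦ ‖z‖ ^ α := continuous_norm.rpow_const fun _ ↦ .inr hα
  unfold powNl
  fun_prop

theorem rpow_sub_rpow_mul_le {α a b : ℝ} (hα : 0 ≤ α) (hb : 0 ≤ b) (hab : b ≤ a) :
    (a ^ α - b ^ α) * b ≤ α * a ^ α * (a - b) := by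
  rcases hb.eq_or_lt with rfl | hb
  · have : 0 ≤ a ^ α := by positivity
    rw [mul_zero, sub_zero]
    positivity
  have ha : 0 < a := hb.trans_le hab
  have hbernoulli := one_add_mul_self_le_rpow_one_add (s := b / a - 1) (p := 1 + α)
    (by linarith [show 0 ≤ b / a by positivity]) (by linarith)
  rw [add_sub_cancel, Real.div_rpow hb.le ha.le, le_div_iff₀ (by positivity), Real.rpow_add ha,
    Real.rpow_add hb, Real.rpow_one, Real.rpow_one] at hbernoulli
  have hleft : (1 + (1 + α) * (b / a - 1)) * (a * a ^ α) = a ^ α * (a + (1 + α) * (b - a)) := by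
    field_simp
  linarith

theorem norm_powNl_sub_le {α : ℝ} (hα : 0 ≤ α) {M : ℝ} {z w : ℂ} (hz : ‖z‖ ≤ M)
    (hw : ‖w‖ ≤ M) : ‖powNl α z - powNl α w‖ ≤ (1 + α) * M ^ α * ‖z - w‖ := by
  wlog h : ‖w‖ ≤ ‖z‖ generalizing z w
  · rw [norm_sub_rev, norm_sub_rev z w]
    exact this hw hz (le_of_not_ge h)
  have hsplit : powNl α z - powNl α w
      = ((‖z‖ ^ α : ℝ) : ℂ) * (z - w) + ((‖z‖ ^ α - ‖w‖ ^ α : ℝ) : ℂ) * w := by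
    unfold powNl
    push_cast
    ring
  have hpow : ‖w‖ ^ α ≤ ‖z‖ ^ α := by gcongr
  calc ‖powNl α z - powNl α w‖
      ≤ ‖z‖ ^ α * ‖z - w‖ + (‖z‖ ^ α - ‖w‖ ^ α) * ‖w‖ := by
        rw [hsplit]
        refine (norm_add_le _ _).trans_eq ?_
        rw [norm_mul, norm_mul, Complex.norm_real, Complex.norm_real,
          Real.norm_of_nonneg (by positivity), Real.norm_of_nonneg (sub_nonneg.2 hpow)]
    _ ≤ ‖z‖ ^ α * ‖z - w‖ + α * ‖z‖ ^ α * (‖z‖ - ‖w‖) := by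
        exact add_le_add_right (rpow_sub_rpow_mul_le hα (norm_nonneg _) h) _
    _ ≤ ‖z‖ ^ α * ‖z - w‖ + α * ‖z‖ ^ α * ‖z - w‖ := by
        gcongr
        exact norm_sub_norm_le _ _
    _ = (1 + α) * ‖z‖ ^ α * ‖z - w‖ := by ring
    _ ≤ (1 + α) * M ^ α * ‖z - w‖ := by gcongr

/-! ### Mild solutions -/

theorem mul_integral_mul_exp (C E t : ℝ) :
    C * ∫ σ in (0 : ℝ)..t, E * Real.exp (2 * C * σ) = E / 2 * (Real.exp (2 * C * t) - 1) := by
  rcases eq_or_ne C 0 with rfl | hC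
  · simp
  · rw [intervalIntegral.integral_const_mul,
      intervalIntegral.integral_comp_mul_left _ (by positivity)]
    simp only [mul_zero, integral_exp, Real.exp_zero, smul_eq_mul]
    field_simp

/-- A Gronwall inequality without measurability assumptions: the hypothesis `H` says that every
majorant of `d` can be improved. -/
theorem le_mul_exp_of_forall_majorant {X : Type*} {d : ℝ → X → ℝ} {T C A D : ℝ} (hC : 0 ≤ C)
    (hD : 0 ≤ D) (hA : ∀ t ∈ Icc 0 T, ∀ x, d t x ≤ A)
    (H : ∀ b : ℝ → ℝ, Continuous b → (∀ σ, 0 ≤ b σ) → (∀ σ ∈ Icc 0 T, ∀ x, d σ x ≤ b σ) →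
      ∀ t ∈ Icc 0 T, ∀ x, d t x ≤ D + C * ∫ σ in (0 : ℝ)..t, b σ)
    {t : ℝ} (ht : t ∈ Icc 0 T) (x : X) : d t x ≤ 2 * D * Real.exp (2 * C * t) := by
  let S (p : Icc 0 T × X) : ℝ := max 0 (d p.1 p.2) * Real.exp (-(2 * C * p.1))
  have hexp (t : ℝ) : Real.exp (-(2 * C * t)) * Real.exp (2 * C * t) = 1 := by
    rw [← Real.exp_add, neg_add_cancel, Real.exp_zero]
  have hbdd : BddAbove (range S) := by
    refine ⟨max 0 A, forall_mem_range.2 fun p ↦ mul_le_of_le_one_right (le_max_left _ _) ?_ |>.trans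
      (max_le_max_left 0 (hA _ p.1.2 _))⟩
    exact Real.exp_le_one_iff.2 (neg_nonpos.2 (mul_nonneg (by positivity) p.1.2.1))
  have hmaj {t : ℝ} (ht : t ∈ Icc 0 T) (x : X) : d t x ≤ iSup S * Real.exp (2 * C * t) :=
    calc d t x ≤ max 0 (d t x) := le_max_right _ _
      _ = S (⟨t, ht⟩, x) * Real.exp (2 * C * t) := by
        rw [mul_assoc, hexp, mul_one]
      _ ≤ iSup S * Real.exp (2 * C * t) := by gcongr; exact le_ciSup hbdd _
  have hS : 0 ≤ iSup S := Real.iSup_nonneg fun p ↦ by positivity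
  have himproved : iSup S ≤ D + iSup S / 2 := by
    refine Real.iSup_le (fun p ↦ ?_) (by positivity)
    have hone : 1 ≤ Real.exp (2 * C * p.1) :=
      Real.one_le_exp (mul_nonneg (by positivity) p.1.2.1)
    have hd := H (fun σ ↦ iSup S * Real.exp (2 * C * σ)) (by fun_prop) (fun σ ↦ by positivity)
      (fun σ hσ ↦ hmaj hσ) p.1 p.1.2 p.2
    rw [mul_integral_mul_exp] at hd
    have hmax : max 0 (d p.1 p.2) ≤ (D + iSup S / 2) * Real.exp (2 * C * p.1) :=
      max_le (by positivity) (by nlinarith)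
    calc S p ≤ (D + iSup S / 2) * Real.exp (2 * C * p.1) * Real.exp (-(2 * C * p.1)) :=
          mul_le_mul_of_nonneg_right hmax (Real.exp_nonneg _)
      _ = D + iSup S / 2 := by rw [mul_assoc, mul_comm (Real.exp _), hexp, mul_one]
  refine (hmaj ht x).trans ?_
  gcongr
  linarith

/-- A function on space-time, continuous and bounded by `M`, which satisfies on `[0, T]` Duhamel's
formula with initial value `u 0` for `∂ₜ u = Δ u + lam |u|^α u`. -/
structure IsMild (α : ℝ) (lam : ℂ) (T M : ℝ) (u : ℝ → Space N → ℂ) : Prop where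
  cont : Continuous fun p : ℝ × Space N ↦ u p.1 p.2
  bound : ∀ t x, ‖u t x‖ ≤ M
  duhamel : ∀ t ∈ Icc 0 T, ∀ x,
    u t x = heatSemigroup t (u 0) x + lam * duhamel (fun σ y ↦ powNl α (u σ y)) t x

namespace IsMild

variable {α T M : ℝ} {lam : ℂ} {u v : ℝ → Space N → ℂ}

theorem nonneg (hu : IsMild α lam T M u) : 0 ≤ M :=
  (norm_nonneg _).trans (hu.bound 0 0)

theorem cont_space (hu : IsMild α lam T M u) (t : ℝ) : Continuous (u t) :=
  hu.cont.uncurry_left t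

theorem cont_powNl (hα : 0 ≤ α) (hu : IsMild α lam T M u) :
    Continuous fun p : ℝ × Space N ↦ powNl α (u p.1 p.2) :=
  (continuous_powNl hα).comp hu.cont

theorem bound_powNl (hα : 0 ≤ α) (hu : IsMild α lam T M u) (t : ℝ) (x : Space N) :
    ‖powNl α (u t x)‖ ≤ M ^ α * M :=
  norm_powNl_le hα (hu.bound t x)

theorem mono (hu : IsMild α lam T M u) {T' M' : ℝ} (hT : T' ≤ T) (hM : M ≤ M') :
    IsMild α lam T' M' u where
  cont := hu.cont
  bound t x := (hu.bound t x).trans hM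
  duhamel t ht := hu.duhamel t ⟨ht.1, ht.2.trans hT⟩

theorem comp_add (hu : IsMild α lam T M u) (k : Space N) :
    IsMild α lam T M (fun t x ↦ u t (x + k)) where
  cont := hu.cont.comp (f := fun p : ℝ × Space N ↦ (p.1, p.2 + k)) (by fun_prop)
  bound t x := hu.bound _ _
  duhamel t ht x := by
    rw [hu.duhamel t ht, heatSemigroup_comp_add, duhamel_comp_add fun σ y ↦ powNl α (u σ y)]

theorem comp_isometry (hu : IsMild α lam T M u) (L : Space N ≃ₗᵢ[ℝ] Space N) :
    IsMild α lam T M (fun t x ↦ u t (L x)) where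
  cont := hu.cont.comp (f := fun p : ℝ × Space N ↦ (p.1, L p.2)) (by fun_prop)
  bound t x := hu.bound _ _
  duhamel t ht x := by
    rw [hu.duhamel t ht, heatSemigroup_comp_isometry,
      duhamel_comp_isometry fun σ y ↦ powNl α (u σ y)]

theorem neg (hu : IsMild α lam T M u) : IsMild α lam T M (fun t x ↦ -u t x) where
  cont := hu.cont.neg
  bound t x := (norm_neg _).trans_le (hu.bound _ _)
  duhamel t ht x := by
    simp only [hu.duhamel t ht, heatSemigroup_neg, powNl_neg, duhamel_neg, neg_add, mul_neg]

theorem norm_sub_le (hα : 0 ≤ α) (hu : IsMild α lam T M u) (hv : IsMild α lam T M v) {D : ℝ}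
    (hD : ∀ x, ‖u 0 x - v 0 x‖ ≤ D) {t : ℝ} (ht : t ∈ Icc 0 T) (x : Space N) :
    ‖u t x - v t x‖ ≤ 2 * D * Real.exp (2 * (‖lam‖ * ((1 + α) * M ^ α)) * t) := by
  have hM := hu.nonneg
  refine le_mul_exp_of_forall_majorant (d := fun t x ↦ ‖u t x - v t x‖) (A := M + M)
    (by positivity) ((norm_nonneg _).trans (hD 0))
    (fun t _ x ↦ (_root_.norm_sub_le _ _).trans (add_le_add (hu.bound _ _) (hv.bound _ _)))
    (fun b hb _ hle t ht x ↦ ?_) ht x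
  have hheat : ‖heatSemigroup t (u 0) x - heatSemigroup t (v 0) x‖ ≤ D := by
    rw [← heatSemigroup_sub t (hu.cont_space 0) (hv.cont_space 0) (hu.bound 0) (hv.bound 0)]
    exact norm_heatSemigroup_le t hD x
  have hduhamel := norm_duhamel_le_integral (g := fun σ y ↦ powNl α (u σ y) - powNl α (v σ y))
    (hb.const_mul ((1 + α) * M ^ α)) ht.1 (fun σ hσ y ↦ (norm_powNl_sub_le hα (hu.bound _ _)
      (hv.bound _ _)).trans (by gcongr; exact hle σ ⟨hσ.1, hσ.2.trans ht.2⟩ y)) x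
  rw [duhamel_sub (hu.cont_powNl hα) (hu.bound_powNl hα) (hv.cont_powNl hα) (hv.bound_powNl hα),
    intervalIntegral.integral_const_mul] at hduhamel
  rw [hu.duhamel t ht, hv.duhamel t ht, add_sub_add_comm, ← mul_sub, mul_assoc]
  refine (norm_add_le _ _).trans (add_le_add hheat ?_)
  rw [norm_mul]
  gcongr

theorem apply_nonpos {lam : ℝ} (hα : 0 ≤ α) (hlam : 0 ≤ lam) (hu : IsMild α (lam : ℂ) T M u)
    (ℓ : ℂ →L[ℝ] ℝ) (hℓ : ∀ x, ℓ (u 0 x) ≤ 0) {t : ℝ} (ht : t ∈ Icc 0 T) (x : Space N) :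
    ℓ (u t x) ≤ 0 := by
  have hM := hu.nonneg
  suffices h : ℓ (u t x) ≤ 2 * 0 * Real.exp (2 * (lam * M ^ α) * t) by simpa using h
  refine le_mul_exp_of_forall_majorant (d := fun t x ↦ ℓ (u t x)) (A := ‖ℓ‖ * M)
    (by positivity) le_rfl (fun t _ x ↦ (le_abs_self _).trans <| (ℓ.le_opNorm _).trans
      (by gcongr; exact hu.bound t x)) (fun b hb hb₀ hle t ht x ↦ ?_) ht x
  have hheat : ℓ (heatSemigroup t (u 0) x) ≤ 0 :=
    apply_heatSemigroup_le ℓ t (hu.cont_space 0) (hu.bound 0) hℓ x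
  have hduhamel : ℓ (NLHeat.duhamel (fun σ y ↦ powNl α (u σ y)) t x)
      ≤ ∫ σ in (0 : ℝ)..t, M ^ α * b σ := by
    refine apply_duhamel_le_integral ℓ (hu.cont_powNl hα) (hu.bound_powNl hα)
      (hb.const_mul _) ht.1 (fun σ hσ y ↦ ?_) x
    rw [apply_powNl]
    exact (mul_le_mul_of_nonneg_left (hle σ ⟨hσ.1, hσ.2.trans ht.2⟩ y) (by positivity)).trans
      (by gcongr; exacts [hb₀ σ, hu.bound σ y])
  rw [intervalIntegral.integral_const_mul] at hduhamel
  rw [hu.duhamel t ht, map_add, ← Complex.real_smul, map_smul, smul_eq_mul, mul_assoc]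
  gcongr

theorem eq_ofReal_norm {lam : ℝ} (hα : 0 ≤ α) (hlam : 0 ≤ lam)
    (hu : IsMild α (lam : ℂ) T M u) (h₀ : ∀ x, u 0 x = (‖u 0 x‖ : ℂ)) {t : ℝ} (ht : t ∈ Icc 0 T)
    (x : Space N) : u t x = (‖u t x‖ : ℂ) := by
  have him₀ (y : Space N) : (u 0 y).im = 0 := by rw [h₀ y, Complex.ofReal_im]
  have hre₀ (y : Space N) : 0 ≤ (u 0 y).re := by
    rw [h₀ y, Complex.ofReal_re]
    exact norm_nonneg _
  have him_le := hu.apply_nonpos hα hlam Complex.imCLM (fun y ↦ (him₀ y).le) ht x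
  have him_ge := hu.apply_nonpos hα hlam (-Complex.imCLM) (fun y ↦ by simp [him₀ y]) ht x
  have hre := hu.apply_nonpos hα hlam (-Complex.reCLM) (fun y ↦ by simp [hre₀ y]) ht x
  simp only [Complex.imCLM_apply, _root_.neg_apply, Complex.reCLM_apply,
    Left.neg_nonpos_iff] at him_le him_ge hre
  have hreal : u t x = ((u t x).re : ℂ) := Complex.ext rfl (le_antisymm him_le him_ge)
  rw [hreal, Complex.norm_real, Real.norm_of_nonneg hre]

theorem weak_form (hα : 0 ≤ α) (hu : IsMild α lam T M u) (h : 𝓢(Space N, ℂ)) {t : ℝ}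
    (ht : t ∈ Icc 0 T) :
    (∫ x, u t x * h x) - ∫ x, u 0 x * h x
      = (∫ τ in (0 : ℝ)..t, ∫ x, u τ x * (Δ h : 𝓢(Space N, ℂ)) x)
        + lam * ∫ τ in (0 : ℝ)..t, ∫ x, powNl α (u τ x) * h x := by
  let g (σ : ℝ) (y : Space N) : ℂ := powNl α (u σ y)
  let I (k : 𝓢(Space N, ℂ)) (τ : ℝ) : ℂ := ∫ x, heatSemigroup τ (u 0) x * k x
  let J (k : 𝓢(Space N, ℂ)) (τ : ℝ) : ℂ := ∫ x, NLHeat.duhamel g τ x * k x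
  have hgc : Continuous fun p : ℝ × Space N ↦ g p.1 p.2 := hu.cont_powNl hα
  have hgb : ∀ σ y, ‖g σ y‖ ≤ M ^ α * M := hu.bound_powNl hα
  have hheatc : Continuous fun p : ℝ × Space N ↦ heatSemigroup p.1 (u 0) p.2 :=
    continuous_heatSemigroup (F := fun _ ↦ u 0) ((hu.cont_space 0).comp continuous_snd)
      (fun _ ↦ hu.bound 0) continuous_fst continuous_snd
  have hheatb (τ : ℝ) : ∀ x, ‖heatSemigroup τ (u 0) x‖ ≤ M := norm_heatSemigroup_le τ (hu.bound 0)
  have hsplit (k : 𝓢(Space N, ℂ)) {τ : ℝ} (hτ : τ ∈ Icc 0 T) :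
      ∫ x, u τ x * k x = I k τ + lam * J k τ := by
    have hduhamel : Integrable fun x ↦ NLHeat.duhamel g τ x * k x :=
      integrable_mul_schwartz ((continuous_duhamel hgc hgb).uncurry_left τ)
        (norm_duhamel_le hτ.1 fun σ _ ↦ hgb σ) k
    have hheat : Integrable fun x ↦ heatSemigroup τ (u 0) x * k x :=
      integrable_mul_schwartz (f := heatSemigroup τ (u 0))
        (hheatc.comp (f := fun x ↦ (τ, x)) (by fun_prop)) (hheatb τ) k
    rw [← integral_const_mul, ← integral_add hheat (hduhamel.const_mul lam)]
    congr 1 with x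
    rw [hu.duhamel τ hτ]
    ring
  have hΔ : ∫ τ in (0 : ℝ)..t, ∫ x, u τ x * (Δ h : 𝓢(Space N, ℂ)) x
      = (∫ τ in (0 : ℝ)..t, I (Δ h) τ) + lam * ∫ τ in (0 : ℝ)..t, J (Δ h) τ := by
    rw [← intervalIntegral.integral_const_mul, ← intervalIntegral.integral_add
      ((continuous_integral_mul_schwartz (F := fun τ ↦ heatSemigroup τ (u 0)) hheatc hheatb
        _).intervalIntegrable _ _)
      (((continuous_integral_duhamel_mul hgc hgb _).const_mul lam).intervalIntegrable _ _)]
    refine intervalIntegral.integral_congr fun τ hτ ↦ hsplit _ ?_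
    rw [uIcc_of_le ht.1] at hτ
    exact ⟨hτ.1, hτ.2.trans ht.2⟩
  rw [hΔ, hsplit h ht]
  linear_combination integral_heatSemigroup_mul_sub (hu.cont_space 0) (hu.bound 0) h ht.1
    + lam * integral_duhamel_mul_eq hgc hgb h ht.1

end IsMild

/-! ### Sobolev norms of Schwartz functions -/

theorem toDistribution_apply (f : C₀(Space N, ℂ)) (h : 𝓢(Space N, ℂ)) :
    toDistribution f h = ∫ x, f x * h x := by
  rw [toDistribution, Lp.toTemperedDistribution_apply]
  refine integral_congr_ae ?_
  filter_upwards [(f.toBCF.memLp_top (μ := volume)).coeFn_toLp] with x hx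
  rw [hx, smul_eq_mul, mul_comm]
  rfl

/-- The square of the `H^s` norm of a Schwartz function, on the Fourier side. -/
def hsEnergy (s : ℝ) (h : 𝓢(Space N, ℂ)) : ℝ :=
  ∫ ξ, (1 + ‖ξ‖ ^ 2) ^ s * ‖𝓕 h ξ‖ ^ 2

theorem norm_sq_smulLeftCLM_bessel (s : ℝ) (h : 𝓢(Space N, ℂ)) (ξ : Space N) :
    ‖SchwartzMap.smulLeftCLM ℂ (fun x : Space N ↦ (((1 + ‖x‖ ^ 2) ^ (s / 2) : ℝ) : ℂ)) h ξ‖ ^ 2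
      = (1 + ‖ξ‖ ^ 2) ^ s * ‖h ξ‖ ^ 2 := by
  rw [SchwartzMap.smulLeftCLM_apply_apply (by fun_prop), smul_eq_mul, norm_mul, mul_pow,
    Complex.norm_real, Real.norm_of_nonneg (by positivity), ← Real.rpow_mul_natCast (by positivity),
    Nat.cast_ofNat, div_mul_cancel₀ _ two_ne_zero]

theorem integrable_bessel_mul (s : ℝ) (h : 𝓢(Space N, ℂ)) :
    Integrable fun ξ ↦ (1 + ‖ξ‖ ^ 2) ^ s * ‖h ξ‖ ^ 2 := by
  simp only [← norm_sq_smulLeftCLM_bessel]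
  exact (memLp_two_iff_integrable_sq_norm (SchwartzMap.continuous _).aestronglyMeasurable).1
    (SchwartzMap.memLp _ 2 _)

theorem integral_bessel_mul_fourierInv (s : ℝ) (h : 𝓢(Space N, ℂ)) :
    ∫ ξ, (1 + ‖ξ‖ ^ 2) ^ s * ‖𝓕⁻ h ξ‖ ^ 2 = hsEnergy s h := by
  rw [hsEnergy, ← integral_neg_eq_self]
  simp [SchwartzMap.fourierInv_coe, SchwartzMap.fourier_coe, Real.fourierInv_eq_fourier_neg]

theorem norm_toLp_two (h : 𝓢(Space N, ℂ)) : ‖h.toLp 2‖ = √(∫ x, ‖h x‖ ^ 2) := by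
  simp [SchwartzMap.norm_toLp', Real.sqrt_eq_rpow]

theorem norm_integral_mul_le {X : Type*} [MeasurableSpace X] {μ : Measure X} {k : X → ℂ}
    (hk : MemLp k 2 μ) (g : Lp ℂ 2 μ) : ‖∫ x, g x * k x ∂μ‖ ≤ ‖g‖ * √(∫ x, ‖k x‖ ^ 2 ∂μ) := by
  have htwo : ENNReal.ofReal 2 = 2 := by simp
  have hölder := integral_mul_norm_le_Lp_mul_Lq Real.HolderConjugate.two_two
    (by rw [htwo]; exact Lp.memLp g) (by rwa [htwo])
  have hg : ‖g‖ = √(∫ x, ‖g x‖ ^ 2 ∂μ) := by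
    rw [Lp.norm_def, (Lp.memLp g).eLpNorm_eq_integral_rpow_norm (by simp) (by simp),
      ENNReal.toReal_ofReal (by positivity), Real.sqrt_eq_rpow]
    simp
  calc ‖∫ x, g x * k x ∂μ‖ ≤ ∫ x, ‖g x‖ * ‖k x‖ ∂μ := by
        simpa only [norm_mul] using norm_integral_le_integral_norm (fun x ↦ g x * k x)
    _ ≤ ‖g‖ * √(∫ x, ‖k x‖ ^ 2 ∂μ) := by
        rw [hg, Real.sqrt_eq_rpow, Real.sqrt_eq_rpow]
        simpa only [Real.rpow_two] using hölder

/-- An `H^s` function defines a functional that is bounded in the `H^{-s}` norm. -/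
theorem MemHs.exists_norm_integral_mul_le {s : ℝ} {f : C₀(Space N, ℂ)} (hf : MemHs s f) :
    ∃ M, 0 ≤ M ∧ ∀ h : 𝓢(Space N, ℂ), ‖∫ x, f x * h x‖ ≤ M * √(hsEnergy (-s) h) := by
  obtain ⟨g, hg⟩ := hf
  rw [← besselPotential_neg_apply_eq_iff] at hg
  refine ⟨‖g‖, norm_nonneg _, fun h ↦ ?_⟩
  rw [← toDistribution_apply, ← hg, besselPotential, fourierMultiplierCLM_apply_apply,
    Lp.toTemperedDistribution_apply]
  simp only [smul_eq_mul, mul_comm _ (g _)]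
  refine (norm_integral_mul_le (SchwartzMap.memLp _ 2 _) g).trans_eq ?_
  rw [SchwartzMap.integral_norm_sq_fourier]
  simp only [norm_sq_smulLeftCLM_bessel, integral_bessel_mul_fourierInv]

theorem hsNorm_le_enorm {s : ℝ} {f : C₀(Space N, ℂ)} (g : Lp ℂ 2 (volume : Measure (Space N)))
    (hg : besselPotential (Space N) ℂ s (toDistribution f) = (g : 𝓢'(Space N, ℂ))) :
    hsNorm s f ≤ ‖g‖ₑ := by
  unfold hsNorm
  exact iInf₂_le g hg

theorem hsNorm_le {s : ℝ} {f : C₀(Space N, ℂ)} (h : 𝓢(Space N, ℂ)) (hf : ∀ x, f x = h x) :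
    hsNorm s f ≤ ENNReal.ofReal √(hsEnergy s h) := by
  obtain ⟨k, hk⟩ : ∃ k : 𝓢(Space N, ℂ), k = SchwartzMap.fourierMultiplierCLM ℂ
    (fun x : Space N ↦ (((1 + ‖x‖ ^ 2) ^ (s / 2) : ℝ) : ℂ)) h := ⟨_, rfl⟩
  have hfh : toDistribution f = (h : 𝓢'(Space N, ℂ)) := by
    ext g
    simp [toDistribution_apply, hf, mul_comm]
  have hfk : besselPotential (Space N) ℂ s (toDistribution f)
      = ((k.toLp 2 : Lp ℂ 2 (volume : Measure (Space N))) : 𝓢'(Space N, ℂ)) := by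
    rw [besselPotential, hfh, Lp.toTemperedDistribution_toLp_eq,
      fourierMultiplierCLM_toTemperedDistributionCLM_eq (by fun_prop), hk]
  have henergy : ∫ x, ‖k x‖ ^ 2 = hsEnergy s h := by
    rw [← SchwartzMap.integral_norm_sq_fourier, hk, SchwartzMap.fourierMultiplierCLM_apply,
      FourierTransform.fourier_fourierInv_eq]
    simp only [norm_sq_smulLeftCLM_bessel, hsEnergy]
  refine (hsNorm_le_enorm _ hfk).trans_eq ?_
  rw [← ofReal_norm, norm_toLp_two, henergy]

/-! ### Blow-up of nonnegative solutions -/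

theorem heatSemigroup_ofReal (t : ℝ) (f : Space N → ℝ) (x : Space N) :
    heatSemigroup t (fun y ↦ (f y : ℂ)) x
      = ((∫ z, f (x - √(2 * t) • z) ∂stdGaussian (Space N) : ℝ) : ℂ) := by
  rw [heatSemigroup_eq_integral_stdGaussian, integral_complex_ofReal]

/-- Jensen's inequality for the heat kernel and the power `1 + α`. -/
theorem rpow_re_heatSemigroup_le {α : ℝ} (hα : 0 < α) (t : ℝ) {f : Space N → ℝ}
    (hf : Continuous f) (hf₀ : ∀ y, 0 ≤ f y) {M : ℝ} (hM : ∀ y, f y ≤ M) (x : Space N) :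
    (heatSemigroup t (fun y ↦ (f y : ℂ)) x).re ^ (1 + α)
      ≤ (heatSemigroup t (fun y ↦ powNl α (f y)) x).re := by
  simp only [powNl_ofReal hα (hf₀ _), heatSemigroup_ofReal, Complex.ofReal_re]
  have hpow : Continuous fun r : ℝ ↦ r ^ (1 + α) := Real.continuous_rpow_const (by positivity)
  refine (convexOn_rpow (by linarith : 1 ≤ 1 + α)).map_integral_le hpow.continuousOn isClosed_Ici
    (.of_forall fun z ↦ hf₀ _) (.of_bound (by fun_prop) M (.of_forall fun z ↦ ?_))
    (.of_bound (hpow.comp (by fun_prop)).aestronglyMeasurable (M ^ (1 + α))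
      (.of_forall fun z ↦ ?_))
  · rw [Real.norm_of_nonneg (hf₀ _)]
    exact hM _
  · rw [Function.comp_apply, Real.norm_of_nonneg (Real.rpow_nonneg (hf₀ _) _)]
    exact Real.rpow_le_rpow (hf₀ _) (hM _) (by positivity)

theorem heatSemigroup_const_mul (t : ℝ) (c : ℂ) (f : Space N → ℂ) (x : Space N) :
    heatSemigroup t (fun y ↦ c * f y) x = c * heatSemigroup t f x := by
  simp only [heatSemigroup_eq_integral_stdGaussian, integral_const_mul]

theorem heatSemigroup_comp_smul {μ : ℝ} (hμ : 0 ≤ μ) (t : ℝ) (f : Space N → ℂ) (x : Space N) :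
    heatSemigroup t (fun y ↦ f (μ • y)) x = heatSemigroup (μ ^ 2 * t) f (μ • x) := by
  have hsqrt : √(2 * (μ ^ 2 * t)) = μ * √(2 * t) := by
    rw [mul_left_comm, Real.sqrt_mul (sq_nonneg μ), Real.sqrt_sq hμ]
  simp only [heatSemigroup_eq_integral_stdGaussian, hsqrt, smul_sub, smul_smul]

theorem re_heatSemigroup_pos {t : ℝ} (ht : 0 < t) {f : Space N → ℝ} (hf : Continuous f)
    (hc : HasCompactSupport f) (hf₀ : ∀ y, 0 ≤ f y) {y : Space N} (hy : f y ≠ 0) (x : Space N) :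
    0 < (heatSemigroup t (fun y ↦ (f y : ℂ)) x).re := by
  have hkernel : Continuous fun y : Space N ↦ heatKernel t (x - y) := by
    unfold heatKernel
    fun_prop
  simp only [heatSemigroup, if_pos ht, ← Complex.ofReal_mul, integral_complex_ofReal,
    Complex.ofReal_re]
  exact (hkernel.mul hf).integral_pos_of_hasCompactSupport_nonneg_nonzero hc.mul_left
    (fun y ↦ mul_nonneg (heatKernel_pos ht _).le (hf₀ y)) (mul_ne_zero (heatKernel_pos ht _).ne' hy)

theorem heatSemigroup_duhamel {r t : ℝ} (hr : 0 ≤ r) (ht : 0 ≤ t) {g : ℝ → Space N → ℂ}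
    (hg : Continuous fun p : ℝ × Space N ↦ g p.1 p.2) {C : ℝ} (hC : ∀ σ y, ‖g σ y‖ ≤ C)
    (x : Space N) :
    heatSemigroup r (duhamel g t) x = ∫ σ in (0 : ℝ)..t, heatSemigroup (r + t - σ) (g σ) x := by
  have hcont : Continuous fun p : Space N × ℝ ↦
      heatSemigroup (t - p.2) (g p.2) (x - √(2 * r) • p.1) :=
    (continuous_heatSemigroup_apply hg hC).comp
      (f := fun p : Space N × ℝ ↦ (t - p.2, p.2, x - √(2 * r) • p.1)) (by fun_prop)
  have hprod : Integrable (Function.uncurry fun σ z ↦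
      heatSemigroup (t - σ) (g σ) (x - √(2 * r) • z))
      ((volume.restrict (uIoc 0 t)).prod (stdGaussian (Space N))) := by
    have : IsFiniteMeasure ((volume : Measure ℝ).restrict (uIoc 0 t)) := by
      rw [uIoc]; infer_instance
    exact .of_bound (hcont.comp continuous_swap).aestronglyMeasurable C
      (.of_forall fun p ↦ norm_heatSemigroup_le _ (hC p.1) _)
  rw [heatSemigroup_eq_integral_stdGaussian]
  simp only [duhamel]
  rw [← intervalIntegral_integral_swap hprod]
  refine intervalIntegral.integral_congr fun σ hσ ↦ ?_
  rw [uIcc_of_le ht] at hσ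
  rw [add_sub_assoc, ← heatSemigroup_heatSemigroup hr (sub_nonneg.2 hσ.2) (hg.uncurry_left σ)
    (hC σ), heatSemigroup_eq_integral_stdGaussian r]

/-- `J^{-α} + α lam t` is nonincreasing. -/
theorem mul_rpow_le_one_of_rpow_le_deriv {α lam T : ℝ} (hα : 0 < α) (hT : 0 ≤ T)
    {J J' : ℝ → ℝ} (hJ : ∀ t ∈ Icc 0 T, HasDerivAt J (J' t) t) (hpos : ∀ t ∈ Icc 0 T, 0 < J t)
    (h : ∀ t ∈ Icc 0 T, lam * J t ^ (1 + α) ≤ J' t) : α * lam * T * J 0 ^ α ≤ 1 := by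
  have hderiv : ∀ t ∈ Icc 0 T, HasDerivAt (fun t ↦ J t ^ (-α) + α * lam * t)
      (J' t * (-α) * J t ^ (-α - 1) + α * lam) t := fun t ht ↦
    ((hJ t ht).rpow_const (.inl (hpos t ht).ne')).add (hasDerivAt_const_mul _)
  have hderiv_nonpos : ∀ t ∈ Icc 0 T, J' t * (-α) * J t ^ (-α - 1) + α * lam ≤ 0 := by
    intro t ht
    have hJt := hpos t ht
    have hcancel : J t ^ (1 + α) * J t ^ (-α - 1) = 1 := by
      rw [← Real.rpow_add hJt, show 1 + α + (-α - 1) = 0 by ring, Real.rpow_zero]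
    have hmul := mul_le_mul_of_nonneg_right (h t ht) (Real.rpow_nonneg hJt.le (-α - 1))
    rw [mul_assoc, hcancel, mul_one] at hmul
    nlinarith
  have hanti : AntitoneOn (fun t ↦ J t ^ (-α) + α * lam * t) (Icc 0 T) :=
    antitoneOn_of_hasDerivWithinAt_nonpos (convex_Icc 0 T)
      (fun t ht ↦ (hderiv t ht).continuousAt.continuousWithinAt)
      (fun t ht ↦ (hderiv t (interior_subset ht)).hasDerivWithinAt)
      fun t ht ↦ hderiv_nonpos t (interior_subset ht)
  have hJ0 := hpos 0 (left_mem_Icc.2 hT)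
  have hJT : 0 < J T ^ (-α) := Real.rpow_pos_of_pos (hpos T (right_mem_Icc.2 hT)) _
  have hends := hanti (left_mem_Icc.2 hT) (right_mem_Icc.2 hT) hT
  simp only [mul_zero, add_zero] at hends
  calc α * lam * T * J 0 ^ α ≤ J 0 ^ (-α) * J 0 ^ α := by gcongr; linarith
    _ = 1 := by rw [← Real.rpow_add hJ0, neg_add_cancel, Real.rpow_zero]

namespace IsMild

theorem heatSemigroup_sub_apply {α T M : ℝ} {lam : ℂ} {u : ℝ → Space N → ℂ} (hα : 0 ≤ α)
    (hu : IsMild α lam T M u) {t : ℝ} (ht : t ∈ Icc 0 T) (x : Space N) :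
    heatSemigroup (T - t) (u t) x = heatSemigroup T (u 0) x
      + lam * ∫ σ in (0 : ℝ)..t, heatSemigroup (T - σ) (fun y ↦ powNl α (u σ y)) x := by
  have hheat : Continuous (heatSemigroup t (u 0)) :=
    continuous_heatSemigroup (F := fun _ ↦ u 0) ((hu.cont_space 0).comp continuous_snd)
      (fun _ ↦ hu.bound 0) continuous_const continuous_id
  have hdiff : (fun y ↦ u t y - heatSemigroup t (u 0) y)
      = fun y ↦ lam * NLHeat.duhamel (fun σ y ↦ powNl α (u σ y)) t y := by
    ext y
    rw [hu.duhamel t ht, add_sub_cancel_left]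
  have hTt : 0 ≤ T - t := sub_nonneg.2 ht.2
  have hsub := heatSemigroup_sub (T - t) (hu.cont_space t) hheat (hu.bound t)
    (norm_heatSemigroup_le t (hu.bound 0)) x
  rw [hdiff, heatSemigroup_const_mul,
    heatSemigroup_duhamel hTt ht.1 (hu.cont_powNl hα) (hu.bound_powNl hα),
    heatSemigroup_heatSemigroup hTt ht.1 (hu.cont_space 0) (hu.bound 0), sub_add_cancel] at hsub
  rw [hsub, add_sub_cancel]

/-- Along a nonnegative solution, `J(t) = e^{(T-t)Δ} u(t)` satisfies `J' ≥ lam J^{1+α}`. -/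
theorem mul_rpow_re_heatSemigroup_le_one {α T M lam : ℝ} {u : ℝ → Space N → ℂ} (hα : 0 < α)
    (hlam : 0 ≤ lam) (hT : 0 ≤ T) (hu : IsMild α (lam : ℂ) T M u)
    (h₀ : ∀ x, u 0 x = (‖u 0 x‖ : ℂ)) (x : Space N) (hpos : 0 < (heatSemigroup T (u 0) x).re) :
    α * lam * T * (heatSemigroup T (u 0) x).re ^ α ≤ 1 := by
  let q (σ : ℝ) : ℝ := (heatSemigroup (T - σ) (fun y ↦ powNl α (u σ y)) x).re
  let J (t : ℝ) : ℝ := (heatSemigroup T (u 0) x).re + lam * ∫ σ in (0 : ℝ)..t, q σ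
  have hint := continuous_duhamel_integrand (hu.cont_powNl hα.le) (hu.bound_powNl hα.le) T x
  have hq : Continuous q := Complex.continuous_re.comp hint
  have hJ (t : ℝ) : HasDerivAt J (lam * q t) t :=
    ((hq.integral_hasStrictDerivAt 0 t).hasDerivAt.const_mul lam).const_add _
  have hJu {t : ℝ} (ht : t ∈ Icc 0 T) : J t = (heatSemigroup (T - t) (u t) x).re := by
    rw [hu.heatSemigroup_sub_apply hα.le ht, Complex.add_re, Complex.re_ofReal_mul]
    exact congrArg (_ + lam * ·)
      (Complex.reCLM.intervalIntegral_comp_comm (hint.intervalIntegrable _ _))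
  have hJq {t : ℝ} (ht : t ∈ Icc 0 T) : J t ^ (1 + α) ≤ q t := by
    have hut := funext (hu.eq_ofReal_norm hα.le hlam h₀ ht)
    have hjensen := rpow_re_heatSemigroup_le hα (T - t) (hu.cont_space t).norm
      (fun y ↦ norm_nonneg _) (hu.bound t) x
    simp only [← congrFun hut] at hjensen
    rwa [hJu ht]
  have hq₀ {t : ℝ} (ht : t ∈ Icc 0 T) : 0 ≤ q t := by
    have hcont : Continuous fun y ↦ powNl α (u t y) :=
      (continuous_powNl hα.le).comp (hu.cont_space t)
    have hle := apply_heatSemigroup_le (-Complex.reCLM) (T - t)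
      hcont (hu.bound_powNl hα.le t) (D := 0) (fun y ↦ ?_) x
    · simpa using hle
    · rw [apply_powNl, hu.eq_ofReal_norm hα.le hlam h₀ ht y]
      simp only [_root_.neg_apply, Complex.reCLM_apply, Complex.ofReal_re, mul_neg]
      exact neg_nonpos.2 (by positivity)
  have hJpos {t : ℝ} (ht : t ∈ Icc 0 T) : 0 < J t :=
    add_pos_of_pos_of_nonneg hpos (mul_nonneg hlam (intervalIntegral.integral_nonneg ht.1
      fun σ hσ ↦ hq₀ ⟨hσ.1, hσ.2.trans ht.2⟩))
  simpa [J] using mul_rpow_le_one_of_rpow_le_deriv hα hT (fun t _ ↦ hJ t) (fun _ ↦ hJpos)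
    fun t ht ↦ mul_le_mul_of_nonneg_left (hJq ht) hlam

end IsMild

theorem IsSolutionOn.apply_zero {α : ℝ} {lam : ℂ} {φ : C₀(Space N, ℂ)} {T : ℝ≥0∞}
    {u : ℝ → C₀(Space N, ℂ)} (hu : IsSolutionOn α lam φ T u) (hT : 0 < T) : u 0 = φ := by
  ext x
  rw [hu.duhamel 0 le_rfl (by simpa using hT), heatSemigroup_zero,
    intervalIntegral.integral_same, mul_zero, add_zero]

theorem IsSolutionOn.exists_isMild {α : ℝ} {lam : ℂ} {φ : C₀(Space N, ℂ)} {T : ℝ≥0∞}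
    {u : ℝ → C₀(Space N, ℂ)} (hu : IsSolutionOn α lam φ T u) {T₁ : ℝ} (hT₁ : 0 ≤ T₁)
    (h : ENNReal.ofReal T₁ < T) :
    ∃ M, IsMild α lam T₁ M fun t x ↦ u (projIcc 0 T₁ hT₁ t) x := by
  have hlt {t : ℝ} (ht : t ≤ T₁) : ENNReal.ofReal t < T :=
    (ENNReal.ofReal_le_ofReal ht).trans_lt h
  have hc : Continuous fun t : ℝ ↦ u (projIcc 0 T₁ hT₁ t) :=
    hu.continuousOn.comp_continuous (by fun_prop)
      fun t ↦ ⟨(projIcc 0 T₁ hT₁ t).2.1, hlt (projIcc 0 T₁ hT₁ t).2.2⟩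
  have hu₀ : u 0 = φ := hu.apply_zero (zero_le.trans_lt h)
  obtain ⟨M, hM⟩ := isCompact_Icc.exists_bound_of_continuousOn (s := Icc 0 T₁) hc.continuousOn
  refine ⟨M, ?_, fun t x ↦ ?_, fun t ht x ↦ ?_⟩
  · have hbcf : Continuous fun t : ℝ ↦ (u (projIcc 0 T₁ hT₁ t)).toBCF :=
      ZeroAtInftyContinuousMap.isometry_toBCF.continuous.comp hc
    exact (hbcf.comp continuous_fst).eval continuous_snd
  · refine ((u (projIcc 0 T₁ hT₁ t)).toBCF.norm_coe_le_norm x).trans ?_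
    rw [ZeroAtInftyContinuousMap.norm_toBCF_eq_norm]
    simpa only [projIcc_val] using hM _ (projIcc 0 T₁ hT₁ t).2
  · simp only [projIcc_left, hu₀, projIcc_of_mem hT₁ ht, hu.duhamel t ht.1 (hlt ht.2),
      NLHeat.duhamel]
    congr 2
    refine intervalIntegral.integral_congr fun σ hσ ↦ ?_
    rw [uIcc_of_le ht.1] at hσ
    simp only [powNl, projIcc_of_mem hT₁ ⟨hσ.1, hσ.2.trans ht.2⟩]

theorem exists_isMild_of_lt_maximalTime {α : ℝ} {lam : ℂ} {φ : C₀(Space N, ℂ)} {T : ℝ}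
    (hT : 0 ≤ T) (h : ENNReal.ofReal T < maximalTime α lam φ) :
    ∃ (M : ℝ) (u : ℝ → Space N → ℂ), IsMild α lam T M u ∧ u 0 = φ := by
  obtain ⟨T', ⟨u, hu⟩, hT'⟩ := lt_sSup_iff.1 h
  obtain ⟨M, hM⟩ := hu.exists_isMild hT hT'
  refine ⟨M, _, hM, ?_⟩
  simp only [projIcc_left]
  rw [hu.apply_zero (zero_le.trans_lt hT')]

theorem maximalTime_le_of_one_lt {α lam t : ℝ} (hα : 0 < α) (hlam : 0 ≤ lam)
    {φ : C₀(Space N, ℂ)} (hφ : ∀ x, φ x = (‖φ x‖ : ℂ)) (ht : 0 ≤ t) (x : Space N)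
    (hpos : 0 < (heatSemigroup t φ x).re)
    (h : 1 < α * lam * t * (heatSemigroup t φ x).re ^ α) :
    maximalTime α (lam : ℂ) φ ≤ ENNReal.ofReal t := by
  by_contra! hlt
  obtain ⟨M, u, hu, hu₀⟩ := exists_isMild_of_lt_maximalTime ht hlt
  have hle := hu.mul_rpow_re_heatSemigroup_le_one hα hlam ht (hu₀ ▸ hφ) x (hu₀ ▸ hpos)
  rw [hu₀] at hle
  exact hle.not_gt h

theorem fourier_comp_smul {μ : ℝ} (hμ : 0 < μ) (f : Space N → ℂ) (ξ : Space N) :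
    𝓕 (fun x : Space N ↦ f (μ • x)) ξ = ((μ ^ N)⁻¹ : ℝ) * 𝓕 f (μ⁻¹ • ξ) := by
  have hscale := Measure.integral_comp_smul (volume : Measure (Space N))
    (fun x ↦ Real.fourierChar (-inner ℝ x (μ⁻¹ • ξ)) • f x) μ
  rw [finrank_euclideanSpace_fin, abs_of_pos (by positivity), Complex.real_smul] at hscale
  rw [Real.fourier_eq, Real.fourier_eq, ← hscale]
  simp only [inner_smul_left, inner_smul_right, RCLike.conj_to_real, inv_mul_cancel_left₀ hμ.ne']

theorem norm_fourier_of_eq_comp_smul {b h : 𝓢(Space N, ℂ)} {c μ : ℝ} (hμ : 0 < μ)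
    (hh : ∀ x, h x = c * b (μ • x)) (η : Space N) :
    ‖𝓕 h (μ • η)‖ = |c| * (μ ^ N)⁻¹ * ‖𝓕 b η‖ := by
  have hsmul (g : Space N → ℂ) (ξ : Space N) : 𝓕 ((c : ℂ) • g) ξ = (c : ℂ) • 𝓕 g ξ :=
    congrFun (VectorFourier.fourierIntegral_const_smul _ _ _ _ _) ξ
  have hcoe : (h : Space N → ℂ) = (c : ℂ) • fun x ↦ b (μ • x) := funext hh
  rw [SchwartzMap.fourier_coe, hcoe, hsmul, fourier_comp_smul hμ, inv_smul_smul₀ hμ.ne',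
    SchwartzMap.fourier_coe, norm_smul, norm_mul, Complex.norm_real, Complex.norm_real,
    Real.norm_of_nonneg (by positivity : 0 ≤ (μ ^ N)⁻¹), Real.norm_eq_abs, mul_assoc]

theorem hsEnergy_le_of_eq_comp_smul {s : ℝ} (hs : 0 ≤ s) {b h : 𝓢(Space N, ℂ)} {c μ : ℝ}
    (hμ : 1 ≤ μ) (hh : ∀ x, h x = c * b (μ • x)) :
    hsEnergy s h ≤ c ^ 2 * μ ^ (2 * s - N) * hsEnergy s b := by
  have hμ₀ : 0 < μ := one_pos.trans_le hμ
  have hscale := Measure.integral_comp_inv_smul (volume : Measure (Space N))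
    (fun η ↦ (1 + ‖μ • η‖ ^ 2) ^ s * ‖𝓕 h (μ • η)‖ ^ 2) μ
  simp only [smul_inv_smul₀ hμ₀.ne', finrank_euclideanSpace_fin, abs_of_pos (pow_pos hμ₀ N),
    smul_eq_mul, norm_fourier_of_eq_comp_smul hμ₀ hh] at hscale
  have hweight (η : Space N) : (1 + ‖μ • η‖ ^ 2) ^ s ≤ μ ^ (2 * s) * (1 + ‖η‖ ^ 2) ^ s := by
    rw [Real.rpow_mul hμ₀.le, Real.rpow_two, ← Real.mul_rpow (by positivity) (by positivity),
      norm_smul, Real.norm_of_nonneg hμ₀.le]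
    exact Real.rpow_le_rpow (by positivity) (by nlinarith) hs
  calc hsEnergy s h = μ ^ N * ∫ η, (1 + ‖μ • η‖ ^ 2) ^ s
        * (|c| * (μ ^ N)⁻¹ * ‖𝓕 b η‖) ^ 2 := hscale
    _ ≤ μ ^ N * ∫ η, μ ^ (2 * s) * (c ^ 2 * (μ ^ N)⁻¹ ^ 2)
        * ((1 + ‖η‖ ^ 2) ^ s * ‖𝓕 b η‖ ^ 2) := by
      refine mul_le_mul_of_nonneg_left (integral_mono_of_nonneg (.of_forall fun η ↦ by positivity)
        ((integrable_bessel_mul s (𝓕 b)).const_mul _) (.of_forall fun η ↦ ?_)) (by positivity)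
      calc _ ≤ μ ^ (2 * s) * (1 + ‖η‖ ^ 2) ^ s * (|c| * (μ ^ N)⁻¹ * ‖𝓕 b η‖) ^ 2 := by
            exact mul_le_mul_of_nonneg_right (hweight η) (sq_nonneg _)
        _ = _ := by rw [mul_pow, mul_pow, sq_abs]; ring
    _ = c ^ 2 * μ ^ (2 * s - N) * hsEnergy s b := by
      rw [integral_const_mul, ← hsEnergy, Real.rpow_sub hμ₀, Real.rpow_natCast]
      field_simp

theorem exists_one_le_rpow_mul_le {p : ℝ} (hp : p < 0) (C : ℝ) {ε T : ℝ} (hε : 0 < ε)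
    (hT : 0 < T) : ∃ μ : ℝ, 1 ≤ μ ∧ (μ ^ 2)⁻¹ < T ∧ C * μ ^ p ≤ ε := by
  have hpow : Filter.Tendsto (fun μ : ℝ ↦ C * μ ^ p) Filter.atTop (nhds 0) := by
    simpa using (tendsto_rpow_neg_atTop (neg_pos.2 hp)).const_mul C
  have hinv : Filter.Tendsto (fun μ : ℝ ↦ (μ ^ 2)⁻¹) Filter.atTop (nhds 0) :=
    (Filter.tendsto_pow_atTop two_ne_zero).inv_tendsto_atTop
  exact ((Filter.eventually_ge_atTop 1).and
    ((hinv.eventually_lt_const hT).and (hpow.eventually_le_const hε))).exists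

theorem exists_one_lt_mul_rpow {α a κ : ℝ} (hα : 0 < α) (ha : 0 < a) (hκ : 0 < κ) :
    ∃ A : ℝ, 0 < A ∧ 1 < a * (A * κ) ^ α := by
  have htendsto : Filter.Tendsto (fun A : ℝ ↦ a * (A * κ) ^ α) Filter.atTop Filter.atTop :=
    ((tendsto_rpow_atTop hα).comp (Filter.tendsto_id.atTop_mul_const hκ)).const_mul_atTop ha
  exact ((Filter.eventually_gt_atTop 0).and (htendsto.eventually_gt_atTop 1)).exists

theorem heatSemigroup_rescale {μ : ℝ} (hμ : 0 < μ) (c : ℂ) (f : Space N → ℂ) :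
    heatSemigroup (μ ^ 2)⁻¹ (fun x ↦ c * f (μ • x)) 0 = c * heatSemigroup 1 f 0 := by
  rw [heatSemigroup_const_mul, heatSemigroup_comp_smul hμ.le, mul_inv_cancel₀ (by positivity),
    smul_zero]

theorem maximalTime_le_of_eq_rescale {α lam A μ : ℝ} (hα : 0 < α) (hlam : 0 ≤ lam) (hA : 0 < A)
    (hμ : 0 < μ) {b : Space N → ℝ} (hb : ∀ x, 0 ≤ b x)
    (hκ : 0 < (heatSemigroup 1 (fun y ↦ (b y : ℂ)) 0).re)
    (hAκ : 1 < α * lam * (A * (heatSemigroup 1 (fun y ↦ (b y : ℂ)) 0).re) ^ α)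
    {φ : C₀(Space N, ℂ)} (hφ : ∀ x, φ x = ((A * μ ^ (2 / α) : ℝ) : ℂ) * b (μ • x)) :
    maximalTime α (lam : ℂ) φ ≤ ENNReal.ofReal (μ ^ 2)⁻¹ := by
  set κ := (heatSemigroup 1 (fun y ↦ (b y : ℂ)) 0).re
  have hheat : (heatSemigroup (μ ^ 2)⁻¹ φ 0).re = A * μ ^ (2 / α) * κ := by
    rw [funext hφ, heatSemigroup_rescale hμ _ fun x ↦ (b x : ℂ), Complex.re_ofReal_mul]
  refine maximalTime_le_of_one_lt hα hlam (fun x ↦ ?_) (by positivity) 0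
    (hheat ▸ by positivity) ?_
  · rw [hφ, ← Complex.ofReal_mul, Complex.norm_of_nonneg (mul_nonneg (by positivity) (hb _))]
  · have hpow : (A * μ ^ (2 / α) * κ) ^ α = μ ^ 2 * (A * κ) ^ α := by
      rw [mul_right_comm, mul_comm, Real.mul_rpow (by positivity) (by positivity),
        ← Real.rpow_mul hμ.le, div_mul_cancel₀ _ hα.ne', Real.rpow_two]
    rwa [hheat, hpow, mul_assoc, inv_mul_cancel_left₀ (by positivity)]

/-- Below the scaling exponent, the data `A μ^{2/α} b(μ x)` become small in `H^s` as `μ → ∞`,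
while their life span is at most `μ⁻²` once `A` is large. -/
theorem exists_hsNorm_le_maximalTime_lt {α lam s : ℝ} (hα : 0 < α) (hlam : 0 < lam) (hs : 0 ≤ s)
    (hsN : s < N / 2 - 2 / α) {δ T : ℝ} (hδ : 0 < δ) (hT : 0 < T) :
    ∃ φ : C₀(Space N, ℂ), ContDiff ℝ ∞ (φ : Space N → ℂ) ∧ HasCompactSupport (φ : Space N → ℂ) ∧
      hsNorm s φ ≤ ENNReal.ofReal δ ∧ maximalTime α (lam : ℂ) φ < ENNReal.ofReal T := by
  obtain ⟨b⟩ : Nonempty (ContDiffBump (0 : Space N)) := inferInstance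
  have hbd : ContDiff ℝ ∞ fun x ↦ (b x : ℂ) := Complex.ofRealCLM.contDiff.comp b.contDiff
  have hbc : HasCompactSupport fun x ↦ (b x : ℂ) :=
    b.hasCompactSupport.comp_left (g := Complex.ofReal) rfl
  let B : 𝓢(Space N, ℂ) := hbc.toSchwartzMap hbd
  have hκ := re_heatSemigroup_pos one_pos b.continuous b.hasCompactSupport (fun _ ↦ b.nonneg)
    (b.one_of_mem_closedBall (Metric.mem_closedBall_self b.rIn_pos.le) ▸ one_ne_zero) 0
  obtain ⟨A, hA, hAκ⟩ := exists_one_lt_mul_rpow hα (mul_pos hα hlam) hκ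
  obtain ⟨μ, hμ₁, hμT, hμδ⟩ := exists_one_le_rpow_mul_le
    (p := 2 / α * 2 + (2 * s - N)) (by linarith) (A ^ 2 * hsEnergy s B) (pow_pos hδ 2) hT
  have hμ : 0 < μ := one_pos.trans_le hμ₁
  have hdata : ContDiff ℝ ∞ fun x ↦ ((A * μ ^ (2 / α) : ℝ) : ℂ) * B (μ • x) :=
    contDiff_const.mul (hbd.comp (contDiff_const_smul μ))
  have hcompact : HasCompactSupport fun x ↦ ((A * μ ^ (2 / α) : ℝ) : ℂ) * B (μ • x) :=
    (hbc.comp_homeomorph (Homeomorph.smulOfNeZero μ hμ.ne')).mul_left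
  let h : 𝓢(Space N, ℂ) := hcompact.toSchwartzMap hdata
  have henergy : hsEnergy s h ≤ δ ^ 2 := by
    refine (hsEnergy_le_of_eq_comp_smul (b := B) hs hμ₁ fun _ ↦ rfl).trans (le_of_eq_of_le ?_ hμδ)
    rw [mul_pow, ← Real.rpow_mul_natCast hμ.le, Nat.cast_ofNat, Real.rpow_add hμ]
    ring
  exact ⟨h.toZeroAtInfty, hdata, hcompact,
    (hsNorm_le h fun _ ↦ rfl).trans
      (ENNReal.ofReal_le_ofReal ((Real.sqrt_le_left hδ.le).2 henergy)),
    (maximalTime_le_of_eq_rescale hα hlam.le hA hμ (fun _ ↦ b.nonneg) hκ hAκ fun _ ↦ rfl).trans_lt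
      ((ENNReal.ofReal_lt_ofReal_iff hT).2 hμT)⟩

theorem not_locallyWellPosedSmallData_of_lt {α lam s : ℝ} (hα : 0 < α) (hlam : 0 < lam)
    (hs : 0 ≤ s) (hsN : s < N / 2 - 2 / α) :
    ¬ LocallyWellPosedSmallData N s α (lam : ℂ) := by
  rintro ⟨δ, T, hδ, hT, hwp⟩
  obtain ⟨φ, hsmooth, hcompact, hnorm, hlt⟩ :=
    exists_hsNorm_le_maximalTime_lt hα hlam hs hsN hδ hT
  exact hlt.not_ge (hwp φ hsmooth hcompact hnorm).1

/-! ### Uniqueness and existence on the maximal interval -/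

theorem IsSolutionOn.eq_of_lt {α : ℝ} {lam : ℂ} {φ : C₀(Space N, ℂ)} {T T' : ℝ≥0∞}
    {u v : ℝ → C₀(Space N, ℂ)} (hα : 0 ≤ α) (hu : IsSolutionOn α lam φ T u)
    (hv : IsSolutionOn α lam φ T' v) {t : ℝ} (ht : 0 ≤ t) (h : ENNReal.ofReal t < T)
    (h' : ENNReal.ofReal t < T') : u t = v t := by
  obtain ⟨M, hM⟩ := hu.exists_isMild ht h
  obtain ⟨M', hM'⟩ := hv.exists_isMild ht h'
  ext x
  have hle := (hM.mono le_rfl (le_max_left M M')).norm_sub_le hα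
    (hM'.mono le_rfl (le_max_right M M')) (D := 0) (fun y ↦ ?_) ⟨ht, le_rfl⟩ x
  · simpa [sub_eq_zero] using hle
  · simp [hu.apply_zero (zero_le.trans_lt h), hv.apply_zero (zero_le.trans_lt h')]

theorem exists_isSolutionOn_maximalTime {α : ℝ} (hα : 0 ≤ α) (lam : ℂ) (φ : C₀(Space N, ℂ)) :
    ∃ u, IsSolutionOn α lam φ (maximalTime α lam φ) u := by
  have hex (t : ℝ) : ∃ (T : ℝ≥0∞) (v : ℝ → C₀(Space N, ℂ)),
      ENNReal.ofReal t < maximalTime α lam φ →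
        ENNReal.ofReal t < T ∧ IsSolutionOn α lam φ T v := by
    by_cases ht : ENNReal.ofReal t < maximalTime α lam φ
    · obtain ⟨T, ⟨v, hv⟩, hT⟩ := lt_sSup_iff.1 ht
      exact ⟨T, v, fun _ ↦ ⟨hT, hv⟩⟩
    · exact ⟨0, 0, fun h ↦ absurd h ht⟩
  choose τ v hv using hex
  have hglue {t σ : ℝ} (ht : ENNReal.ofReal t < maximalTime α lam φ) (hσ₀ : 0 ≤ σ)
      (hσ : ENNReal.ofReal σ < maximalTime α lam φ) (hσt : ENNReal.ofReal σ < τ t) :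
      v σ σ = v t σ :=
    (hv σ hσ).2.eq_of_lt hα (hv t ht).2 hσ₀ (hv σ hσ).1 hσt
  refine ⟨fun t ↦ v t t, fun t ⟨ht₀, ht⟩ ↦ ?_, fun t ht₀ ht x ↦ ?_⟩
  · have hopen : {σ : ℝ | ENNReal.ofReal σ < τ t} ∈ nhds t :=
      (isOpen_lt ENNReal.continuous_ofReal continuous_const).mem_nhds (hv t ht).1
    have hcont := (hv t ht).2.continuousOn t ⟨ht₀, (hv t ht).1⟩
    refine (hcont.mono_of_mem_nhdsWithin ?_).congr_of_eventuallyEq ?_ rfl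
    all_goals
      filter_upwards [mem_nhdsWithin_of_mem_nhds hopen, self_mem_nhdsWithin] with σ hσt hσ
    · exact ⟨hσ.1, hσt⟩
    · exact hglue ht hσ.1 hσ.2 hσt
  · rw [(hv t ht).2.duhamel t ht₀ (hv t ht).1]
    congr 2
    refine intervalIntegral.integral_congr fun σ hσ ↦ ?_
    rw [uIcc_of_le ht₀] at hσ
    have hle := ENNReal.ofReal_le_ofReal hσ.2
    simp only [hglue ht hσ.1 (hle.trans_lt ht) (hle.trans_lt (hv t ht).1)]

/-! ### Solutions with odd data -/

theorem exists_norm_add_sub_le (g : 𝓢(Space N, ℂ)) :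
    ∃ L : ℝ, 0 ≤ L ∧ ∀ x k, ‖g (x + k) - g x‖ ≤ L * ‖k‖ := by
  set g' := SchwartzMap.fderivCLM ℝ (Space N) ℂ g
  refine ⟨‖g'.toBoundedContinuousFunction‖, norm_nonneg _, fun x k ↦ ?_⟩
  simpa using convex_univ.norm_image_sub_le_of_norm_fderiv_le (𝕜 := ℝ) (f := g) (x := x)
    (y := x + k) (fun y _ ↦ (g.hasFDerivAt y).differentiableAt)
    (fun y _ ↦ g'.toBoundedContinuousFunction.norm_coe_le_norm y) (mem_univ _) (mem_univ _)

theorem norm_heatSemigroup_sub_self_add_sub_le (h : 𝓢(Space N, ℂ)) {D : ℝ} {k : Space N}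
    (hD : ∀ x, ‖(Δ h : 𝓢(Space N, ℂ)) (x + k) - (Δ h : 𝓢(Space N, ℂ)) x‖ ≤ D) {t : ℝ}
    (ht : 0 ≤ t) (x : Space N) :
    ‖(heatSemigroup t h (x + k) - h (x + k)) - (heatSemigroup t h x - h x)‖ ≤ D * t := by
  set g : 𝓢(Space N, ℂ) := Δ h with hg
  have hbound (y : Space N) : ‖g y‖ ≤ ‖g.toBoundedContinuousFunction‖ :=
    g.toBoundedContinuousFunction.norm_coe_le_norm y
  have hint (y : Space N) : IntervalIntegrable (fun r ↦ heatSemigroup r g y) volume 0 t :=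
    (continuous_heatSemigroup (F := fun _ ↦ g) (by fun_prop) (fun _ ↦ hbound) continuous_id
      continuous_const).intervalIntegrable _ _
  rw [heatSemigroup_sub_self h ht, heatSemigroup_sub_self h ht, ← hg,
    ← intervalIntegral.integral_sub (hint _) (hint _)]
  refine (intervalIntegral.norm_integral_le_of_norm_le_const fun r _ ↦ ?_).trans_eq
    (by rw [sub_zero, abs_of_nonneg ht])
  rw [← heatSemigroup_comp_add, ← heatSemigroup_sub r (f := fun y ↦ g (y + k)) (by fun_prop)
    g.continuous (fun y ↦ hbound (y + k)) hbound]
  exact norm_heatSemigroup_le r hD x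

/-- Reflection in the hyperplane `x i = 0`. -/
def reflectCoord (i : Fin N) : Space N ≃ₗᵢ[ℝ] Space N :=
  LinearIsometryEquiv.piLpCongrRight 2 fun j ↦
    if j = i then LinearIsometryEquiv.neg ℝ else LinearIsometryEquiv.refl ℝ ℝ

theorem reflectCoord_apply (i j : Fin N) (x : Space N) :
    reflectCoord i x j = if j = i then -x j else x j := by
  simp only [reflectCoord, LinearIsometryEquiv.piLpCongrRight_apply]
  split_ifs <;> simp

theorem reflectCoord_sub_smul_single (i : Fin N) (x : Space N) :
    reflectCoord i (x - x i • EuclideanSpace.single i (1 : ℝ))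
      = x - x i • EuclideanSpace.single i (1 : ℝ) := by
  ext j
  rw [reflectCoord_apply]
  split_ifs with hj
  · simp [hj]
  · rfl

namespace IsMild

variable {α T M : ℝ} {lam : ℂ} {u : ℝ → Space N → ℂ}

/-- The deviation of a solution from smooth data is Lipschitz with a constant `O(t)`. -/
theorem exists_norm_sub_add_sub_le (hα : 0 ≤ α) (hu : IsMild α lam T M u) {Φ : 𝓢(Space N, ℂ)}
    (hu₀ : u 0 = Φ) : ∃ K : ℝ, 0 ≤ K ∧ ∀ t ∈ Icc 0 T, ∀ x k,
      ‖(u t (x + k) - Φ (x + k)) - (u t x - Φ x)‖ ≤ K * t * ‖k‖ := by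
  obtain ⟨L, hL, hΦ⟩ := exists_norm_add_sub_le Φ
  obtain ⟨L', hL', hΔ⟩ := exists_norm_add_sub_le (Δ Φ : 𝓢(Space N, ℂ))
  have hM := hu.nonneg
  set γ : ℝ := (1 + α) * M ^ α
  refine ⟨L' + ‖lam‖ * (γ * (2 * L * Real.exp (2 * (‖lam‖ * γ) * T))), by positivity,
    fun t ht x k ↦ ?_⟩
  have hlip : ∀ σ ∈ Icc 0 t, ∀ y, ‖powNl α (u σ (y + k)) - powNl α (u σ y)‖
      ≤ γ * (2 * (L * ‖k‖) * Real.exp (2 * (‖lam‖ * γ) * T)) := by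
    intro σ hσ y
    have hσT := hσ.2.trans ht.2
    refine (norm_powNl_sub_le hα (hu.bound _ _) (hu.bound _ _)).trans ?_
    gcongr
    refine ((hu.comp_add k).norm_sub_le hα hu (D := L * ‖k‖) (fun y ↦ ?_) ⟨hσ.1, hσT⟩ y).trans ?_
    · rw [hu₀]
      exact hΦ y k
    · gcongr
  have hduhamel := norm_duhamel_le ht.1 hlip x
  rw [duhamel_sub ((hu.comp_add k).cont_powNl hα) ((hu.comp_add k).bound_powNl hα)
    (hu.cont_powNl hα) (hu.bound_powNl hα), duhamel_comp_add fun σ y ↦ powNl α (u σ y)] at hduhamel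
  have hheat := norm_heatSemigroup_sub_self_add_sub_le Φ (fun y ↦ hΔ y k) ht.1 x
  rw [hu.duhamel t ht, hu.duhamel t ht, hu₀]
  set d := NLHeat.duhamel fun σ y ↦ powNl α (u σ y)
  calc _ = ‖((heatSemigroup t Φ (x + k) - Φ (x + k)) - (heatSemigroup t Φ x - Φ x))
        + lam * (d t (x + k) - d t x)‖ := by congr 1; ring
    _ ≤ L' * ‖k‖ * t
        + ‖lam‖ * (t * (γ * (2 * (L * ‖k‖) * Real.exp (2 * (‖lam‖ * γ) * T)))) := by
      refine (norm_add_le _ _).trans (add_le_add hheat ?_)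
      rw [norm_mul]
      gcongr
    _ = _ := by ring

theorem apply_reflectCoord_eq_neg (hα : 0 ≤ α) (hu : IsMild α lam T M u) {i : Fin N}
    (hodd : ∀ x, u 0 (reflectCoord i x) = -u 0 x) {t : ℝ} (ht : t ∈ Icc 0 T) (x : Space N) :
    u t (reflectCoord i x) = -u t x := by
  have hle := (hu.comp_isometry (reflectCoord i)).norm_sub_le hα hu.neg (D := 0)
    (fun y ↦ by simp [hodd]) ht x
  simpa [add_eq_zero_iff_eq_neg] using hle

theorem exists_norm_sub_le_of_odd (hα : 0 ≤ α) (hu : IsMild α lam T M u) {Φ : 𝓢(Space N, ℂ)}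
    (hu₀ : u 0 = Φ) {i : Fin N} (hodd : ∀ x, Φ (reflectCoord i x) = -Φ x) :
    ∃ K : ℝ, 0 ≤ K ∧ ∀ t ∈ Icc 0 T, ∀ x, ‖u t x - Φ x‖ ≤ K * t * |x i| := by
  obtain ⟨K, hK, hlip⟩ := hu.exists_norm_sub_add_sub_le hα hu₀
  refine ⟨K, hK, fun t ht x ↦ ?_⟩
  set k : Space N := x i • EuclideanSpace.single i (1 : ℝ) with hk
  have hfix : reflectCoord i (x - k) = x - k := reflectCoord_sub_smul_single i x
  have hΦ : Φ (x - k) = 0 := self_eq_neg.1 (by rw [← hodd, hfix])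
  have hut : u t (x - k) = 0 :=
    self_eq_neg.1 (by rw [← hu.apply_reflectCoord_eq_neg hα (hu₀ ▸ hodd) ht, hfix])
  have hnorm : ‖k‖ = |x i| := by simp [hk, norm_smul]
  simpa [hΦ, hut, hnorm] using hlip t ht (x - k) k

end IsMild

/-! ### Finite differences of Schwartz functions -/

/-- The backward difference `h(x - k) - h(x)`, the adjoint of the forward difference. -/
def schwartzDiff (k : Space N) (h : 𝓢(Space N, ℂ)) : 𝓢(Space N, ℂ) :=
  h.compSubConstCLM ℂ k - h

theorem integral_mul_schwartzDiff {f : Space N → ℂ} (hf : Continuous f) {M : ℝ}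
    (hM : ∀ x, ‖f x‖ ≤ M) (k : Space N) (h : 𝓢(Space N, ℂ)) :
    ∫ x, f x * schwartzDiff k h x = ∫ x, fwdDiff k f x * h x := by
  have hshift := integrable_mul_schwartz hf hM (h.compSubConstCLM ℂ k)
  have hfshift : Continuous fun x ↦ f (x + k) := by fun_prop
  simp only [schwartzDiff, fwdDiff, _root_.sub_apply, mul_sub, sub_mul]
  rw [integral_sub hshift (integrable_mul_schwartz hf hM h),
    integral_sub (integrable_mul_schwartz hfshift (fun x ↦ hM _) h)
      (integrable_mul_schwartz hf hM h),
    ← integral_add_right_eq_self (fun x ↦ f x * h.compSubConstCLM ℂ k x) k]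
  simp only [SchwartzMap.compSubConstCLM_apply, add_sub_cancel_right]

theorem continuous_fwdDiff_iterate {E F : Type*} [AddCommMonoid E] [TopologicalSpace E]
    [ContinuousAdd E] [AddCommGroup F] [TopologicalSpace F] [IsTopologicalAddGroup F] (k : E)
    {f : E → F} (hf : Continuous f) (n : ℕ) : Continuous ((fwdDiff k)^[n] f) := by
  induction n generalizing f with
  | zero => exact hf
  | succ n ih =>
    rw [Function.iterate_succ_apply]
    exact ih ((hf.comp (continuous_id.add continuous_const)).sub hf)

theorem integral_mul_schwartzDiff_iterate {f : Space N → ℂ} (hf : Continuous f) {M : ℝ}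
    (hM : ∀ x, ‖f x‖ ≤ M) (k : Space N) (h : 𝓢(Space N, ℂ)) (n : ℕ) :
    ∫ x, f x * (schwartzDiff k)^[n] h x = ∫ x, (fwdDiff k)^[n] f x * h x := by
  induction n generalizing f M with
  | zero => rfl
  | succ n ih =>
    rw [Function.iterate_succ_apply', integral_mul_schwartzDiff hf hM,
      ih (f := fwdDiff k f) (continuous_fwdDiff_iterate k hf 1)
        fun x ↦ (norm_sub_le _ _).trans (add_le_add (hM _) (hM _)),
      Function.iterate_succ_apply]

theorem fourier_schwartzDiff (k : Space N) (h : 𝓢(Space N, ℂ)) (ξ : Space N) :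
    𝓕 (schwartzDiff k h) ξ
      = (Complex.exp (Complex.I * (-(2 * Real.pi * inner ℝ k ξ) : ℝ)) - 1) * 𝓕 h ξ := by
  have hshift : 𝓕 (h.compSubConstCLM ℂ k) ξ
      = Complex.exp (Complex.I * (-(2 * Real.pi * inner ℝ k ξ) : ℝ)) * 𝓕 h ξ := by
    rw [SchwartzMap.fourier_coe, SchwartzMap.fourier_coe, Real.fourier_eq', Real.fourier_eq',
      ← integral_const_mul, ← integral_add_right_eq_self _ k]
    refine integral_congr_ae (.of_forall fun x ↦ ?_)
    simp only [SchwartzMap.compSubConstCLM_apply, add_sub_cancel_right, smul_eq_mul]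
    rw [← mul_assoc, ← Complex.exp_add, inner_add_left]
    congr 2
    push_cast
    ring
  have hsub : 𝓕 (schwartzDiff k h) = 𝓕 (h.compSubConstCLM ℂ k) - 𝓕 h :=
    map_sub (fourierCLM ℂ 𝓢(Space N, ℂ)) _ _
  rw [hsub, _root_.sub_apply, hshift, sub_mul, one_mul]

theorem fourier_schwartzDiff_iterate (k : Space N) (h : 𝓢(Space N, ℂ)) (n : ℕ) (ξ : Space N) :
    𝓕 ((schwartzDiff k)^[n] h) ξ
      = (Complex.exp (Complex.I * (-(2 * Real.pi * inner ℝ k ξ) : ℝ)) - 1) ^ n * 𝓕 h ξ := by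
  induction n with
  | zero => simp
  | succ n ih =>
    rw [Function.iterate_succ_apply', fourier_schwartzDiff, ih, ← mul_assoc, ← pow_succ']

theorem norm_exp_I_mul_sub_one_pow_le {p : ℝ} (hp : 0 ≤ p) {n : ℕ} (hpn : p ≤ n) (θ : ℝ) :
    ‖Complex.exp (Complex.I * θ) - 1‖ ^ n ≤ 2 ^ (n - p) * |θ| ^ p := by
  set r := ‖Complex.exp (Complex.I * θ) - 1‖
  have hrθ : r ≤ |θ| := Real.norm_exp_I_mul_ofReal_sub_one_le
  have hr2 : r ≤ 2 := by
    refine (norm_sub_le _ _).trans_eq ?_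
    rw [mul_comm, Complex.norm_exp_ofReal_mul_I, norm_one, one_add_one_eq_two]
  calc r ^ n = r ^ (n - p) * r ^ p := by
        rw [← Real.rpow_add_of_nonneg (norm_nonneg _) (sub_nonneg.2 hpn) hp, sub_add_cancel,
          Real.rpow_natCast]
    _ ≤ 2 ^ (n - p) * |θ| ^ p := by gcongr

theorem bessel_mul_rpow_le_one {s m r : ℝ} (hm : 0 ≤ m) (hms : m ≤ 2 * s) (hr : 0 ≤ r) :
    (1 + r ^ 2) ^ (-s) * r ^ m ≤ 1 := by
  have hrm : r ^ m ≤ (1 + r ^ 2) ^ (m / 2) := by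
    rw [show r ^ m = (r ^ 2) ^ (m / 2) by
      rw [← Real.rpow_two, ← Real.rpow_mul hr, mul_div_cancel₀ _ two_ne_zero]]
    gcongr
    linarith
  calc (1 + r ^ 2) ^ (-s) * r ^ m ≤ (1 + r ^ 2) ^ (-s) * (1 + r ^ 2) ^ (m / 2) := by gcongr
    _ = (1 + r ^ 2) ^ (-s + m / 2) := by rw [← Real.rpow_add (by positivity)]
    _ ≤ 1 := Real.rpow_le_one_of_one_le_of_nonpos (by nlinarith) (by linarith)

theorem norm_sq_fourier_schwartzDiff_iterate_le {p : ℝ} (hp : 0 ≤ p) {n : ℕ} (hpn : p ≤ 2 * n)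
    (k : Space N) (h : 𝓢(Space N, ℂ)) (ξ : Space N) :
    ‖𝓕 ((schwartzDiff k)^[n] h) ξ‖ ^ 2
      ≤ 2 ^ (2 * n - p) * (2 * Real.pi * ‖k‖) ^ p * ‖ξ‖ ^ p * ‖𝓕 h ξ‖ ^ 2 := by
  have hθ : |-(2 * Real.pi * inner ℝ k ξ)| ≤ 2 * Real.pi * ‖k‖ * ‖ξ‖ := by
    rw [abs_neg, abs_mul, abs_of_pos Real.two_pi_pos, mul_assoc _ ‖k‖]
    exact mul_le_mul_of_nonneg_left (abs_real_inner_le_norm k ξ) Real.two_pi_pos.le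
  have hpn' : p ≤ (2 * n : ℕ) := by exact_mod_cast hpn
  rw [fourier_schwartzDiff_iterate, norm_mul, mul_pow, norm_pow, ← pow_mul, mul_comm n]
  refine mul_le_mul_of_nonneg_right ?_ (sq_nonneg _)
  calc _ ≤ 2 ^ (2 * n - p) * |-(2 * Real.pi * inner ℝ k ξ)| ^ p := by
        exact_mod_cast norm_exp_I_mul_sub_one_pow_le hp hpn' _
    _ ≤ 2 ^ (2 * n - p) * (2 * Real.pi * ‖k‖ * ‖ξ‖) ^ p := by gcongr
    _ = 2 ^ (2 * n - p) * (2 * Real.pi * ‖k‖) ^ p * ‖ξ‖ ^ p := by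
        rw [Real.mul_rpow (by positivity) (norm_nonneg ξ), ← mul_assoc]

theorem hsEnergy_neg_schwartzDiff_iterate_le {s p : ℝ} (hp : 0 ≤ p) (hps : p ≤ 2 * s) {n : ℕ}
    (hpn : p ≤ 2 * n) (k : Space N) (h : 𝓢(Space N, ℂ)) :
    hsEnergy (-s) ((schwartzDiff k)^[n] h)
      ≤ 2 ^ (2 * n - p) * (2 * Real.pi * ‖k‖) ^ p * ∫ x, ‖h x‖ ^ 2 := by
  have hint : Integrable fun ξ ↦ ‖𝓕 h ξ‖ ^ 2 := by
    simpa using integrable_bessel_mul 0 (𝓕 h)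
  set C : ℝ := 2 ^ (2 * n - p) * (2 * Real.pi * ‖k‖) ^ p
  rw [← SchwartzMap.integral_norm_sq_fourier, hsEnergy, ← integral_const_mul]
  refine integral_mono_of_nonneg (.of_forall fun ξ ↦ by positivity) (hint.const_mul C)
    (.of_forall fun ξ ↦ ?_)
  calc (1 + ‖ξ‖ ^ 2) ^ (-s) * ‖𝓕 ((schwartzDiff k)^[n] h) ξ‖ ^ 2
      ≤ (1 + ‖ξ‖ ^ 2) ^ (-s) * (C * ‖ξ‖ ^ p * ‖𝓕 h ξ‖ ^ 2) := by
        gcongr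
        exact norm_sq_fourier_schwartzDiff_iterate_le hp hpn k h ξ
    _ = (1 + ‖ξ‖ ^ 2) ^ (-s) * ‖ξ‖ ^ p * (C * ‖𝓕 h ξ‖ ^ 2) := by ring
    _ ≤ C * ‖𝓕 h ξ‖ ^ 2 := mul_le_of_le_one_left (by positivity)
        (bessel_mul_rpow_le_one hp hps (norm_nonneg ξ))

theorem hsEnergy_laplacian_le (s : ℝ) (h : 𝓢(Space N, ℂ)) :
    hsEnergy s (Δ h) ≤ (2 * Real.pi) ^ 4 * hsEnergy (s + 2) h := by
  rw [hsEnergy, hsEnergy, ← integral_const_mul]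
  refine integral_mono_of_nonneg (.of_forall fun ξ ↦ by positivity)
    ((integrable_bessel_mul _ _).const_mul _) (.of_forall fun ξ ↦ ?_)
  have hweight : (‖ξ‖ ^ 2) ^ 2 ≤ (1 + ‖ξ‖ ^ 2) ^ 2 := by gcongr; linarith
  calc (1 + ‖ξ‖ ^ 2) ^ s * ‖𝓕 (Δ h : 𝓢(Space N, ℂ)) ξ‖ ^ 2
      = (2 * Real.pi) ^ 4 * ((1 + ‖ξ‖ ^ 2) ^ s * (‖ξ‖ ^ 2) ^ 2 * ‖𝓕 h ξ‖ ^ 2) := by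
        rw [fourier_laplacian, norm_mul, norm_neg, Complex.norm_real,
          Real.norm_of_nonneg (by positivity)]
        ring
    _ ≤ (2 * Real.pi) ^ 4 * ((1 + ‖ξ‖ ^ 2) ^ s * (1 + ‖ξ‖ ^ 2) ^ 2 * ‖𝓕 h ξ‖ ^ 2) := by gcongr
    _ = (2 * Real.pi) ^ 4 * ((1 + ‖ξ‖ ^ 2) ^ (s + 2) * ‖𝓕 h ξ‖ ^ 2) := by
        rw [Real.rpow_add (by positivity), Real.rpow_two]

/-! ### Test functions concentrated near a hyperplane -/

/-- The linear map that multiplies the `i`-th coordinate by `c` and fixes the other ones. -/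
def stretch (i : Fin N) (c : ℝ) : Space N →ₗ[ℝ] Space N :=
  Matrix.toEuclideanLin (Matrix.diagonal (Function.update 1 i c))

theorem stretch_apply (i j : Fin N) (c : ℝ) (x : Space N) :
    stretch i c x j = Function.update (1 : Fin N → ℝ) i c j * x j := by
  simp [stretch, Matrix.toLpLin_apply, Matrix.mulVec_diagonal]

theorem stretch_eq (i : Fin N) (c : ℝ) (x : Space N) :
    stretch i c x = x + ((c - 1) * x i) • EuclideanSpace.single i (1 : ℝ) := by
  ext j
  rw [stretch_apply]
  obtain rfl | hj := eq_or_ne j i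
  · simp only [Function.update_self, PiLp.add_apply, PiLp.smul_apply, PiLp.single_eq_same,
      smul_eq_mul, mul_one]
    ring
  · simp [hj]

theorem stretch_stretch_inv (i : Fin N) {c : ℝ} (hc : c ≠ 0) (x : Space N) :
    stretch i c (stretch i c⁻¹ x) = x := by
  ext j
  rw [stretch_apply, stretch_apply]
  obtain rfl | hj := eq_or_ne j i
  · simp [hc]
  · simp [hj]

theorem det_stretch (i : Fin N) (c : ℝ) : LinearMap.det (stretch i c) = c := by
  rw [stretch, Matrix.toEuclideanLin, Matrix.toLpLin_eq_toLin, LinearMap.det_toLin,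
    Matrix.det_diagonal, Finset.prod_update_of_mem (Finset.mem_univ i)]
  simp

/-- `stretch i c` as a linear equivalence, for `c ≠ 0`. -/
def stretchEquiv (i : Fin N) {c : ℝ} (hc : c ≠ 0) : Space N ≃L[ℝ] Space N :=
  LinearEquiv.toContinuousLinearEquiv <| LinearEquiv.ofLinearMap (stretch i c) (stretch i c⁻¹)
    (LinearMap.ext (stretch_stretch_inv i hc))
    (LinearMap.ext fun x ↦ by simpa using stretch_stretch_inv i (inv_ne_zero hc) x)

theorem integral_eq_smul_integral_comp_stretch {E : Type*} [NormedAddCommGroup E]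
    [NormedSpace ℝ E] (i : Fin N) {c : ℝ} (hc : 0 < c) (f : Space N → E) :
    ∫ x, f x = c • ∫ y, f (stretch i c y) := by
  have hmap := Measure.map_linearMap_addHaar_eq_smul_addHaar (μ := (volume : Measure (Space N)))
    (f := stretch i c) (by rw [det_stretch]; exact hc.ne')
  have hint : ∫ x, f x ∂Measure.map (stretch i c) volume = ∫ y, f (stretch i c y) :=
    (stretchEquiv i hc.ne').toHomeomorph.measurableEmbedding.integral_map f
  rw [← hint, hmap, det_stretch, abs_of_pos (by positivity), integral_smul_measure,
    ENNReal.toReal_ofReal (by positivity), smul_inv_smul₀ hc.ne']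

/-- The function `x ↦ B (x₁, …, xᵢ / ε, …)`, concentrated at scale `ε` in the `i`-th direction. -/
def squeeze (i : Fin N) {ε : ℝ} (hε : ε ≠ 0) (B : 𝓢(Space N, ℂ)) : 𝓢(Space N, ℂ) :=
  SchwartzMap.compCLMOfContinuousLinearEquiv ℂ (stretchEquiv i (inv_ne_zero hε)) B

theorem squeeze_stretch (i : Fin N) {ε : ℝ} (hε : ε ≠ 0) (B : 𝓢(Space N, ℂ)) (y : Space N) :
    squeeze i hε B (stretch i ε y) = B y := by
  have hinv := stretch_stretch_inv i (inv_ne_zero hε) y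
  rw [inv_inv] at hinv
  exact congr_arg B hinv

/-- The fourth difference at scale `ε` of a function concentrated at scale `ε`. It is small in
negative Sobolev norms, and detects the limited smoothness of `|xᵢ|^α xᵢ`. -/
def thinTest (i : Fin N) {ε : ℝ} (hε : ε ≠ 0) (B : 𝓢(Space N, ℂ)) : 𝓢(Space N, ℂ) :=
  (schwartzDiff (ε • EuclideanSpace.single i 1))^[4] (squeeze i hε B)

theorem integral_mul_thinTest {f : Space N → ℂ} (hf : Continuous f) {M : ℝ}
    (hM : ∀ x, ‖f x‖ ≤ M) (i : Fin N) {ε : ℝ} (hε : 0 < ε) (B : 𝓢(Space N, ℂ)) :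
    ∫ x, f x * thinTest i hε.ne' B x = ε • ∫ y,
      (fwdDiff (ε • EuclideanSpace.single i 1))^[4] f (stretch i ε y) * B y := by
  rw [thinTest, integral_mul_schwartzDiff_iterate hf hM,
    integral_eq_smul_integral_comp_stretch i hε]
  simp only [squeeze_stretch]

theorem hsEnergy_neg_thinTest_le {s p : ℝ} (hp : 0 ≤ p) (hps : p ≤ 2 * s) (hp8 : p ≤ 8)
    (i : Fin N) {ε : ℝ} (hε : 0 < ε) (B : 𝓢(Space N, ℂ)) :
    hsEnergy (-s) (thinTest i hε.ne' B)
      ≤ 2 ^ (8 - p) * (2 * Real.pi) ^ p * (∫ x, ‖B x‖ ^ 2) * ε ^ (p + 1) := by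
  have hk : ‖ε • EuclideanSpace.single i (1 : ℝ)‖ = ε := by
    rw [norm_smul, PiLp.norm_single, norm_one, mul_one, Real.norm_of_nonneg hε.le]
  have hB : ∫ x, ‖squeeze i hε.ne' B x‖ ^ 2 = ε * ∫ x, ‖B x‖ ^ 2 := by
    rw [integral_eq_smul_integral_comp_stretch i hε, smul_eq_mul]
    simp only [squeeze_stretch]
  calc hsEnergy (-s) (thinTest i hε.ne' B)
      ≤ 2 ^ (2 * (4 : ℕ) - p) * (2 * Real.pi * ε) ^ p * (ε * ∫ x, ‖B x‖ ^ 2) := by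
        have hbound := hsEnergy_neg_schwartzDiff_iterate_le hp hps (n := 4)
          (by norm_num; exact hp8) (ε • EuclideanSpace.single i 1) (squeeze i hε.ne' B)
        rwa [hk, hB] at hbound
    _ = 2 ^ (8 - p) * (2 * Real.pi) ^ p * (∫ x, ‖B x‖ ^ 2) * ε ^ (p + 1) := by
        rw [Real.mul_rpow Real.two_pi_pos.le hε.le, Real.rpow_add_one hε.ne']
        norm_num
        ring

/-- Applied to the concave power `α / 2`, Bernoulli's inequality bounds `(9/4)^(α/2)` and
`(1/4)^(α/2)` by tangent lines whose combination is constant. -/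
theorem three_mul_three_rpow_add_five_lt {α : ℝ} (hα : 0 < α) (hα2 : α < 2) :
    3 * (3 : ℝ) ^ α + 5 < 8 * 2 ^ α := by
  have hpow : ∀ a : ℝ, 0 < a → a ^ 2 ≠ 1 → a ^ α < 1 + α / 2 * (a ^ 2 - 1) := fun a ha ha1 ↦ by
    have h := rpow_one_add_lt_one_add_mul_self (s := a ^ 2 - 1) (p := α / 2)
      (by nlinarith) (sub_ne_zero.2 ha1) (by linarith) (by linarith)
    rwa [add_sub_cancel, ← Real.rpow_two, ← Real.rpow_mul ha.le, mul_div_cancel₀ _ two_ne_zero,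
      Real.rpow_two] at h
  have hthree := hpow (3 / 2) (by norm_num) (by norm_num)
  have hone := hpow (1 / 2) (by norm_num) (by norm_num)
  rw [Real.div_rpow (by norm_num) (by norm_num)] at hthree hone
  rw [Real.one_rpow] at hone
  have hsum : (3 * (3 : ℝ) ^ α + 5) / 2 ^ α < 8 := by
    calc (3 * (3 : ℝ) ^ α + 5) / 2 ^ α = 3 * (3 ^ α / 2 ^ α) + 5 * (1 / 2 ^ α) := by ring
      _ < 8 := by linarith
  exact (div_lt_iff₀ (by positivity)).1 hsum

theorem exists_re_fwdDiff_iterate_four_powNl_lt {α : ℝ} (hα : 0 < α) (hα2 : α < 2) :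
    ∃ c r : ℝ, 0 < c ∧ 0 < r ∧ ∀ y, |y + 1| < r →
      ((fwdDiff 1)^[4] (fun y : ℝ ↦ powNl α y) y).re < -(2 * c) := by
  have hcont : Continuous fun y ↦ ((fwdDiff 1)^[4] (fun y : ℝ ↦ powNl α y) y).re :=
    Complex.continuous_re.comp <| continuous_fwdDiff_iterate 1
      ((continuous_powNl hα.le).comp Complex.continuous_ofReal) 4
  have hval : ((fwdDiff 1)^[4] (fun y : ℝ ↦ powNl α y) (-1)).re
      = 3 * (3 : ℝ) ^ α + 5 - 8 * 2 ^ α := by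
    norm_num [fwdDiff_iter_eq_sum_shift, Finset.sum_range_succ, Nat.choose, powNl]
    ring
  have hgap := three_mul_three_rpow_add_five_lt hα hα2
  set gap := 8 * 2 ^ α - (3 * (3 : ℝ) ^ α + 5) with hgap_def
  obtain ⟨r, hr, hball⟩ := Metric.eventually_nhds_iff.1 <|
    hcont.continuousAt.eventually_lt_const
      (hval.trans_lt (by linarith [hgap_def]) : _ < -(2 * (gap / 4)))
  exact ⟨gap / 4, r, by linarith, hr, fun y hy ↦ hball (by rwa [Real.dist_eq, sub_neg_eq_add])⟩

theorem norm_stretch_add_smul_le (i : Fin N) {ε : ℝ} (hε : 0 < ε) (hε' : ε ≤ 1 / 12)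
    {y : Space N} (hy : ‖y + EuclideanSpace.single i (1 : ℝ)‖ ≤ 1 / 4) {j : ℕ} (hj : j ≤ 4) :
    ‖stretch i ε y + j • ε • EuclideanSpace.single i (1 : ℝ)‖ ≤ 1 := by
  set e : Space N := EuclideanSpace.single i (1 : ℝ) with he
  set z := y + e with hz
  have hj' : (j : ℝ) ≤ 4 := by exact_mod_cast hj
  have hnorm : ∀ a : ℝ, ‖a • e‖ = |a| := fun a ↦ by simp [he, norm_smul]
  have hsplit : stretch i ε y + j • ε • e = z + ((ε - 1) * z i) • e + (ε * (j - 1)) • e := by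
    rw [stretch_eq, show z i = y i + 1 by simp [hz, he], hz]
    module
  have hmid : ‖((ε - 1) * z i) • e‖ ≤ 1 / 4 := by
    rw [hnorm, abs_mul]
    calc |ε - 1| * |z i| ≤ 1 * ‖z‖ := by
          gcongr
          · rw [abs_le]; constructor <;> linarith
          · exact PiLp.norm_apply_le z i
      _ ≤ 1 / 4 := by rwa [one_mul]
  have hlast : ‖(ε * (j - 1)) • e‖ ≤ 1 / 4 := by
    rw [hnorm, abs_mul, abs_of_pos hε]
    calc ε * |(j : ℝ) - 1| ≤ 1 / 12 * 3 := by
          gcongr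
          rw [abs_le]; constructor <;> linarith [j.cast_nonneg (α := ℝ)]
      _ = 1 / 4 := by norm_num
  rw [hsplit]
  calc _ ≤ ‖z‖ + ‖((ε - 1) * z i) • e‖ + ‖(ε * (j - 1)) • e‖ := norm_add₃_le
    _ ≤ 1 := by linarith

theorem norm_fwdDiff_iterate_le {E F : Type*} [AddCommMonoid E] [SeminormedAddCommGroup F]
    {f : E → F} {k x : E} {δ : ℝ} {n : ℕ} (h : ∀ j ≤ n, ‖f (x + j • k)‖ ≤ δ) :
    ‖(fwdDiff k)^[n] f x‖ ≤ 2 ^ n * δ := by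
  induction n generalizing f δ with
  | zero => simpa using h 0 le_rfl
  | succ n ih =>
    rw [Function.iterate_succ_apply, pow_succ, mul_assoc]
    refine ih fun j hj ↦ ?_
    calc ‖fwdDiff k f (x + j • k)‖ = ‖f (x + (j + 1) • k) - f (x + j • k)‖ := by
          rw [fwdDiff, add_assoc, succ_nsmul]
      _ ≤ δ + δ := (norm_sub_le _ _).trans
          (add_le_add (h _ (Nat.succ_le_succ hj)) (h _ (Nat.le_succ_of_le hj)))
      _ = 2 * δ := (two_mul δ).symm

theorem powNl_ofReal_mul {c : ℝ} (hc : 0 ≤ c) (α : ℝ) (z : ℂ) :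
    powNl α (c * z) = (c ^ α * c : ℝ) * powNl α z := by
  rw [powNl, powNl, norm_mul, Complex.norm_of_nonneg hc, Real.mul_rpow hc (norm_nonneg z)]
  push_cast
  ring

theorem stretch_add_smul_apply (i : Fin N) (ε : ℝ) (y : Space N) (j : ℕ) :
    (stretch i ε y + j • ε • EuclideanSpace.single i (1 : ℝ)) i = ε * (y i + j) := by
  rw [PiLp.add_apply, stretch_apply]
  simp only [Function.update_self, PiLp.smul_apply, PiLp.single_eq_same, smul_eq_mul, mul_one,
    nsmul_eq_mul]
  ring

theorem fwdDiff_iterate_powNl_coord (i : Fin N) {ε : ℝ} (hε : 0 ≤ ε) (α : ℝ) (n : ℕ)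
    (y : Space N) :
    (fwdDiff (ε • EuclideanSpace.single i (1 : ℝ)))^[n] (fun x ↦ powNl α (x i)) (stretch i ε y)
      = (ε ^ α * ε : ℝ) * (fwdDiff 1)^[n] (fun y : ℝ ↦ powNl α y) (y i) := by
  simp only [fwdDiff_iter_eq_sum_shift, Finset.mul_sum, stretch_add_smul_apply,
    Complex.ofReal_mul ε, powNl_ofReal_mul hε, nsmul_one, mul_smul_comm]

theorem norm_powNl_stretch_add_smul_le (i : Fin N) {α : ℝ} (hα : 0 ≤ α) (hα2 : α ≤ 2) {ε : ℝ}
    (hε : 0 ≤ ε) {y : Space N} (hy : ‖y + EuclideanSpace.single i (1 : ℝ)‖ ≤ 1 / 4) {j : ℕ}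
    (hj : j ≤ 4) :
    ‖powNl α ((stretch i ε y + j • ε • EuclideanSpace.single i (1 : ℝ)) i)‖
      ≤ 216 * (ε ^ α * ε) := by
  have hyi : |y i + 1| ≤ 1 / 4 := by
    simpa using (PiLp.norm_apply_le (y + EuclideanSpace.single i (1 : ℝ)) i).trans hy
  have hyj : ‖((y i + j : ℝ) : ℂ)‖ ≤ 6 := by
    have hj' : (j : ℝ) ≤ 4 := by exact_mod_cast hj
    rw [Complex.norm_real, Real.norm_eq_abs, abs_le]
    constructor <;> linarith [abs_le.1 hyi, j.cast_nonneg (α := ℝ)]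
  have hpow : ‖powNl α (y i + j : ℝ)‖ ≤ 216 :=
    calc ‖powNl α (y i + j : ℝ)‖ ≤ 6 ^ α * 6 := norm_powNl_le hα hyj
      _ ≤ 6 ^ (2 : ℝ) * 6 := by gcongr; norm_num
      _ = 216 := by norm_num
  rw [stretch_add_smul_apply, Complex.ofReal_mul, powNl_ofReal_mul hε, norm_mul,
    Complex.norm_of_nonneg (by positivity), mul_comm]
  gcongr

theorem re_fwdDiff_iterate_four_le (i : Fin N) {α : ℝ} (hα : 0 ≤ α) (hα2 : α ≤ 2)
    {f : Space N → ℂ} {A η : ℝ} (hA : 0 ≤ A) (hη : 0 ≤ η)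
    (hf : ∀ x, ‖x‖ ≤ 1 → ‖f x - A * powNl α (x i)‖ ≤ η * (A * ‖powNl α (x i)‖)) {ε : ℝ}
    (hε : 0 < ε) (hε' : ε ≤ 1 / 12) {y : Space N}
    (hy : ‖y + EuclideanSpace.single i (1 : ℝ)‖ ≤ 1 / 4) :
    ((fwdDiff (ε • EuclideanSpace.single i 1))^[4] f (stretch i ε y)).re
      ≤ A * (ε ^ α * ε) * (((fwdDiff 1)^[4] (fun y : ℝ ↦ powNl α y) (y i)).re + 3456 * η) := by
  set k : Space N := ε • EuclideanSpace.single i 1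
  set P : Space N → ℂ := fun x ↦ powNl α (x i)
  have herr : ‖(fwdDiff k)^[4] (f - A • P) (stretch i ε y)‖
      ≤ 2 ^ 4 * (η * (A * (216 * (ε ^ α * ε)))) := norm_fwdDiff_iterate_le fun j hj ↦ by
    refine (hf _ (norm_stretch_add_smul_le i hε hε' hy hj)).trans ?_
    gcongr
    exact norm_powNl_stretch_add_smul_le i hα hα2 hε.le hy hj
  have hmain : ((fwdDiff k)^[4] (A • P) (stretch i ε y)).re
      = A * (ε ^ α * ε) * ((fwdDiff 1)^[4] (fun y : ℝ ↦ powNl α y) (y i)).re := by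
    rw [fwdDiff_iter_const_smul, Pi.smul_apply, fwdDiff_iterate_powNl_coord i hε.le,
      Complex.real_smul, Complex.re_ofReal_mul, Complex.re_ofReal_mul, mul_assoc A]
  rw [← sub_add_cancel f (A • P), fwdDiff_iter_add, Pi.add_apply, Complex.add_re, hmain]
  linarith [(Complex.re_le_norm _).trans herr]

theorem re_integral_mul_contDiffBump_le {x₀ : Space N} (b : ContDiffBump x₀) {G : Space N → ℂ}
    (hG : Continuous G) {m : ℝ} (hm : ∀ y ∈ Metric.ball x₀ b.rOut, (G y).re ≤ m) :
    (∫ y, G y * (b y : ℂ)).re ≤ m * ∫ y, b y := by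
  have hb : Continuous fun y ↦ (b y : ℂ) := Complex.continuous_ofReal.comp b.continuous
  have hint : Integrable fun y ↦ G y * (b y : ℂ) := (hG.mul hb).integrable_of_hasCompactSupport
    (b.hasCompactSupport.comp_left Complex.ofReal_zero).mul_left
  calc (∫ y, G y * (b y : ℂ)).re = ∫ y, (G y * (b y : ℂ)).re := (integral_re hint).symm
    _ ≤ ∫ y, m * b y := integral_mono hint.re (b.integrable.const_mul m) fun y ↦ by
        simp only [Complex.re_mul_ofReal]
        by_cases hy : y ∈ Function.support b
        · exact mul_le_mul_of_nonneg_right (hm y (b.support_eq ▸ hy)) b.nonneg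
        · simp [Function.notMem_support.1 hy]
    _ = m * ∫ y, b y := integral_const_mul _ _

theorem exists_re_integral_mul_thinTest_le (i : Fin N) {α : ℝ} (hα : 0 < α) (hα2 : α < 2) :
    ∃ (B : 𝓢(Space N, ℂ)) (c η : ℝ), 0 < c ∧ 0 < η ∧ ∀ ε (hε : 0 < ε), ε ≤ 1 / 12 →
      ∀ f : Space N → ℂ, Continuous f → ∀ M, (∀ x, ‖f x‖ ≤ M) → ∀ A : ℝ, 0 ≤ A →
        (∀ x, ‖x‖ ≤ 1 → ‖f x - A * powNl α (x i)‖ ≤ η * (A * ‖powNl α (x i)‖)) →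
        (∫ x, f x * thinTest i hε.ne' B x).re ≤ -(c * A * ε ^ (2 + α)) := by
  obtain ⟨c, r, hc, hr, hdiff⟩ := exists_re_fwdDiff_iterate_four_powNl_lt hα hα2
  set e : Space N := EuclideanSpace.single i (1 : ℝ) with he
  let b : ContDiffBump (-e) := ⟨min r (1 / 4) / 2, min r (1 / 4), by positivity,
    half_lt_self (by positivity)⟩
  have hbsmooth : ContDiff ℝ ∞ fun y ↦ (b y : ℂ) := Complex.ofRealCLM.contDiff.comp b.contDiff
  have hbsupp : HasCompactSupport fun y ↦ (b y : ℂ) :=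
    b.hasCompactSupport.comp_left Complex.ofReal_zero
  refine ⟨hbsupp.toSchwartzMap hbsmooth, c * ∫ y, b y, c / 3456,
    mul_pos hc b.integral_pos, by positivity, fun ε hε hε' f hf M hM A hA hfA ↦ ?_⟩
  have hpoint : ∀ y ∈ Metric.ball (-e) b.rOut,
      ((fwdDiff (ε • e))^[4] f (stretch i ε y)).re ≤ -(c * A * (ε ^ α * ε)) := fun y hy ↦ by
    rw [Metric.mem_ball, dist_eq_norm, sub_neg_eq_add] at hy
    have hyi : |y i + 1| < r :=
      (by simpa [he] using PiLp.norm_apply_le (y + e) i : |y i + 1| ≤ ‖y + e‖).trans_lt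
        (hy.trans_le (min_le_left _ _))
    calc _ ≤ A * (ε ^ α * ε) * (((fwdDiff 1)^[4] (fun y : ℝ ↦ powNl α y) (y i)).re
          + 3456 * (c / 3456)) := re_fwdDiff_iterate_four_le i hα.le hα2.le hA (by positivity)
            hfA hε hε' (hy.le.trans (min_le_right _ _))
      _ ≤ A * (ε ^ α * ε) * -c := by
          gcongr
          linarith [hdiff (y i) hyi]
      _ = -(c * A * (ε ^ α * ε)) := by ring
  have hcont : Continuous fun y ↦ (fwdDiff (ε • e))^[4] f (stretch i ε y) :=
    (continuous_fwdDiff_iterate _ hf 4).comp (LinearMap.continuous_of_finiteDimensional _)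
  rw [integral_mul_thinTest hf hM i hε, Complex.real_smul, Complex.re_ofReal_mul]
  calc _ ≤ ε * (-(c * A * (ε ^ α * ε)) * ∫ y, b y) := by
        gcongr
        exact re_integral_mul_contDiffBump_le b hcont hpoint
    _ = -(c * (∫ y, b y) * A * ε ^ (2 + α)) := by
        rw [Real.rpow_add hε, Real.rpow_two]
        ring

theorem exists_sqrt_hsEnergy_neg_thinTest_le {s p : ℝ} (hp : 0 ≤ p) (hps : p ≤ 2 * s - 4)
    (hp8 : p ≤ 8) (i : Fin N) (B : 𝓢(Space N, ℂ)) :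
    ∃ C : ℝ, ∀ ε (hε : 0 < ε),
      √(hsEnergy (-s) (thinTest i hε.ne' B)) ≤ C * ε ^ ((p + 1) / 2) ∧
      √(hsEnergy (-s) (Δ (thinTest i hε.ne' B))) ≤ C * ε ^ ((p + 1) / 2) := by
  set K := 2 ^ (8 - p) * (2 * Real.pi) ^ p * ∫ x, ‖B x‖ ^ 2
  have hK : 0 ≤ K := by positivity
  refine ⟨√((2 * Real.pi) ^ 4 * K), fun ε hε ↦ ?_⟩
  have hone : 1 ≤ (2 * Real.pi) ^ 4 := one_le_pow₀ (by linarith [Real.pi_gt_three])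
  have hsqrt : √((2 * Real.pi) ^ 4 * K) * ε ^ ((p + 1) / 2)
      = √((2 * Real.pi) ^ 4 * (K * ε ^ (p + 1))) := by
    rw [← mul_assoc _ K, Real.sqrt_mul (mul_nonneg (by positivity) hK),
      Real.sqrt_eq_rpow (ε ^ (p + 1)), ← Real.rpow_mul hε.le, mul_one_div]
  rw [hsqrt]
  constructor <;> refine Real.sqrt_le_sqrt ?_
  · exact (hsEnergy_neg_thinTest_le hp (by linarith) hp8 i hε B).trans
      (le_mul_of_one_le_left (by positivity) hone)
  · refine (hsEnergy_laplacian_le (-s) _).trans ?_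
    rw [show -s + 2 = -(s - 2) by ring]
    gcongr
    exact hsEnergy_neg_thinTest_le hp (by linarith) hp8 i hε B

/-! ### Loss of Sobolev regularity -/

/-- By Baire's theorem, one of the closed sets on which `B = n` works has an interior point. -/
theorem exists_Icc_forall_le_mul {ι : Type*} {F : ι → ℝ → ℝ} {w : ι → ℝ}
    (hF : ∀ i, Continuous (F i)) (hw : ∀ i, 0 ≤ w i) {T : ℝ} (hT : 0 < T)
    (h : ∀ t ∈ Icc 0 T, ∃ B, ∀ i, F i t ≤ B * w i) :
    ∃ a b B : ℝ, 0 < a ∧ a < b ∧ b < T ∧ 0 ≤ B ∧ ∀ t ∈ Icc a b, ∀ i, F i t ≤ B * w i := by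
  let S (n : ℕ) : Set ℝ := {t | ∀ i, F i (projIcc 0 T hT.le t) ≤ n * w i}
  have hclosed (n : ℕ) : IsClosed (S n) := by
    simp only [S, Set.ofPred_forall]
    exact isClosed_iInter fun i ↦ isClosed_le ((hF i).comp (by fun_prop)) continuous_const
  have hcover : ⋃ n, S n = univ := by
    refine eq_univ_of_forall fun t ↦ mem_iUnion.2 ?_
    obtain ⟨B, hB⟩ := h _ (projIcc 0 T hT.le t).2
    obtain ⟨n, hn⟩ := exists_nat_ge B
    exact ⟨n, fun i ↦ (hB i).trans (mul_le_mul_of_nonneg_right hn (hw i))⟩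
  obtain ⟨a, ha, ha'⟩ := (dense_iUnion_interior_of_closed hclosed hcover).inter_open_nonempty
    (Ioo 0 T) isOpen_Ioo (nonempty_Ioo.2 hT)
  obtain ⟨n, hn⟩ := mem_iUnion.1 ha'
  obtain ⟨r, hr, hball⟩ := Metric.isOpen_iff.1 (isOpen_interior.inter isOpen_Ioo) a ⟨hn, ha⟩
  have hsub : ∀ t ∈ Icc a (a + r / 2), t ∈ interior (S n) ∩ Ioo 0 T := fun t ht ↦ hball <| by
    rw [Metric.mem_ball, Real.dist_eq, abs_lt]
    constructor <;> linarith [ht.1, ht.2]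
  refine ⟨a, a + r / 2, n, ha.1, by linarith, (hsub _ ⟨by linarith, le_rfl⟩).2.2,
    n.cast_nonneg, fun t ht i ↦ ?_⟩
  obtain ⟨htS, htT⟩ := hsub t ht
  have hle := interior_subset htS i
  rwa [projIcc_of_mem hT.le (Ioo_subset_Icc_self htT)] at hle

theorem mul_sub_le_norm_integral {F : ℝ → ℂ} (hF : Continuous F) {a b m : ℝ} (hab : a ≤ b)
    (h : ∀ t ∈ Icc a b, (F t).re ≤ -m) : m * (b - a) ≤ ‖∫ t in a..b, F t‖ := by
  have hre : (∫ t in a..b, F t).re = ∫ t in a..b, (F t).re :=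
    (Complex.reCLM.intervalIntegral_comp_comm (hF.intervalIntegrable _ _)).symm
  have hle : ∫ t in a..b, (F t).re ≤ ∫ _ in a..b, -m :=
    intervalIntegral.integral_mono_on hab ((Complex.continuous_re.comp hF).intervalIntegrable _ _)
      intervalIntegrable_const h
  rw [intervalIntegral.integral_const, smul_eq_mul, ← hre] at hle
  linarith [(abs_le.1 (Complex.abs_re_le_norm (∫ t in a..b, F t))).1]

namespace IsMild

variable {α T M : ℝ} {lam : ℂ} {u : ℝ → Space N → ℂ}

theorem mul_integral_powNl_mul (hα : 0 ≤ α) (hu : IsMild α lam T M u) (h : 𝓢(Space N, ℂ))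
    {a b : ℝ} (ha : a ∈ Icc 0 T) (hb : b ∈ Icc 0 T) :
    lam * ∫ τ in a..b, ∫ x, powNl α (u τ x) * h x
      = (∫ x, u b x * h x) - (∫ x, u a x * h x)
        - ∫ τ in a..b, ∫ x, u τ x * (Δ h : 𝓢(Space N, ℂ)) x := by
  have hΔ := continuous_integral_mul_schwartz hu.cont hu.bound (Δ h)
  have hpow := continuous_integral_mul_schwartz (hu.cont_powNl hα) (hu.bound_powNl hα) h
  rw [← intervalIntegral.integral_interval_sub_left (hpow.intervalIntegrable 0 b)
    (hpow.intervalIntegrable 0 a), ← intervalIntegral.integral_interval_sub_left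
    (hΔ.intervalIntegrable 0 b) (hΔ.intervalIntegrable 0 a)]
  linear_combination hu.weak_form hα h ha - hu.weak_form hα h hb

theorem norm_mul_norm_integral_powNl_mul_le (hα : 0 ≤ α) (hu : IsMild α lam T M u)
    (h : 𝓢(Space N, ℂ)) {a b m : ℝ} (ha : 0 ≤ a) (hab : a ≤ b) (hb : b ≤ T)
    (hm : ∀ t ∈ Icc a b, ‖∫ x, u t x * h x‖ ≤ m)
    (hΔ : ∀ t ∈ Icc a b, ‖∫ x, u t x * (Δ h : 𝓢(Space N, ℂ)) x‖ ≤ m) :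
    ‖lam‖ * ‖∫ τ in a..b, ∫ x, powNl α (u τ x) * h x‖ ≤ (2 + (b - a)) * m := by
  have hint : ‖∫ τ in a..b, ∫ x, u τ x * (Δ h : 𝓢(Space N, ℂ)) x‖ ≤ m * |b - a| :=
    intervalIntegral.norm_integral_le_of_norm_le_const fun τ hτ ↦
      hΔ τ (Ioc_subset_Icc_self (uIoc_of_le hab ▸ hτ))
  rw [abs_of_nonneg (sub_nonneg.2 hab)] at hint
  rw [← norm_mul, hu.mul_integral_powNl_mul hα h ⟨ha, hab.trans hb⟩ ⟨ha.trans hab, hb⟩]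
  calc _ ≤ m + m + m * (b - a) :=
        norm_sub_le_of_le (norm_sub_le_of_le (hm b (right_mem_Icc.2 hab))
          (hm a (left_mem_Icc.2 hab))) hint
    _ = (2 + (b - a)) * m := by ring

end IsMild

theorem exists_pos_le_mul_rpow_lt {p : ℝ} (hp : 0 < p) (C : ℝ) {δ r : ℝ} (hδ : 0 < δ)
    (hr : 0 < r) : ∃ ε : ℝ, 0 < ε ∧ ε ≤ r ∧ C * ε ^ p < δ := by
  have hpow : Filter.Tendsto (fun ε : ℝ ↦ C * ε ^ p) (nhdsWithin 0 (Ioi 0)) (nhds 0) := by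
    have htendsto := (Real.continuousAt_rpow_const 0 p (.inr hp.le)).tendsto.const_mul C
    rw [Real.zero_rpow hp.ne', mul_zero] at htendsto
    exact htendsto.mono_left nhdsWithin_le_nhds
  have hmem : ∀ᶠ ε in nhdsWithin (0 : ℝ) (Ioi 0), 0 < ε := self_mem_nhdsWithin
  have hle : ∀ᶠ ε in nhdsWithin (0 : ℝ) (Ioi 0), ε ≤ r :=
    nhdsWithin_le_nhds (eventually_le_nhds hr)
  exact (hmem.and (hle.and (hpow.eventually_lt_const hδ))).exists

/-- A solution with nonlinearity close to `A |xᵢ|^α xᵢ` near the origin does not stay in `H^s`: the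
test functions of scale `ε` see the singularity of the nonlinearity at order `ε^(2+α)`, while
`H^s` regularity makes every other term of the weak formulation of smaller order. -/
theorem exists_not_forall_norm_integral_mul_le (i : Fin N) {α : ℝ} (hα : 0 < α) (hα2 : α < 2) :
    ∃ η : ℝ, 0 < η ∧ ∀ {s : ℝ}, α + 7 / 2 < s → ∀ {lam : ℂ} {T M A : ℝ} {u : ℝ → Space N → ℂ},
      lam ≠ 0 → 0 < T → 0 < A → IsMild α lam T M u →
      (∀ t ∈ Icc 0 T, ∀ x, ‖x‖ ≤ 1 →
        ‖powNl α (u t x) - A * powNl α (x i)‖ ≤ η * (A * ‖powNl α (x i)‖)) →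
      ¬ ∀ t ∈ Icc 0 T, ∃ B : ℝ, ∀ h : 𝓢(Space N, ℂ),
        ‖∫ x, u t x * h x‖ ≤ B * √(hsEnergy (-s) h) := by
  obtain ⟨b, c, η, hc, hη, htest⟩ := exists_re_integral_mul_thinTest_le i hα hα2
  refine ⟨η, hη, fun {s} hs {lam T M A u} hlam hT hA hu hnear hbdd ↦ ?_⟩
  obtain ⟨t₁, t₂, B, ht₁, ht, ht₂, hB, hu_le⟩ := exists_Icc_forall_le_mul
    (fun h ↦ (continuous_integral_mul_schwartz hu.cont hu.bound h).norm)
    (fun h ↦ Real.sqrt_nonneg _) hT hbdd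
  set p := min 8 (2 * s - 4)
  have hp : 3 + 2 * α < p := lt_min (by linarith) (by linarith)
  obtain ⟨C, henergy⟩ := exists_sqrt_hsEnergy_neg_thinTest_le (s := s) (p := p) (by linarith)
    (min_le_right _ _) (min_le_left _ _) i b
  obtain ⟨ε, hε, hε', hsmall⟩ := exists_pos_le_mul_rpow_lt (p := (p + 1) / 2 - (2 + α))
    (δ := ‖lam‖ * (c * A * (t₂ - t₁))) (r := 1 / 12) (by linarith) ((2 + (t₂ - t₁)) * (B * C))
    (mul_pos (norm_pos_iff.2 hlam) (mul_pos (mul_pos hc hA) (sub_pos.2 ht))) (by norm_num)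
  set h := thinTest i hε.ne' b
  set I := ∫ τ in t₁..t₂, ∫ x, powNl α (u τ x) * h x
  have hupper : ‖lam‖ * ‖I‖ ≤ (2 + (t₂ - t₁)) * (B * (C * ε ^ ((p + 1) / 2))) :=
    hu.norm_mul_norm_integral_powNl_mul_le hα.le h ht₁.le ht.le ht₂.le
      (fun t ht ↦ (hu_le t ht _).trans (mul_le_mul_of_nonneg_left (henergy ε hε).1 hB))
      (fun t ht ↦ (hu_le t ht _).trans (mul_le_mul_of_nonneg_left (henergy ε hε).2 hB))
  have hlower : c * A * ε ^ (2 + α) * (t₂ - t₁) ≤ ‖I‖ :=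
    mul_sub_le_norm_integral (continuous_integral_mul_schwartz (hu.cont_powNl hα.le)
      (hu.bound_powNl hα.le) h) ht.le fun t ht' ↦
      htest ε hε hε' (fun x ↦ powNl α (u t x)) ((continuous_powNl hα.le).comp (hu.cont_space t))
        _ (hu.bound_powNl hα.le t) A hA.le (hnear t ⟨ht₁.le.trans ht'.1, ht'.2.trans ht₂.le⟩)
  refine hsmall.not_ge (le_of_mul_le_mul_right ?_ (Real.rpow_pos_of_pos hε (2 + α)))
  calc _ = ‖lam‖ * (c * A * ε ^ (2 + α) * (t₂ - t₁)) := by ring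
    _ ≤ ‖lam‖ * ‖I‖ := by gcongr
    _ ≤ (2 + (t₂ - t₁)) * (B * (C * ε ^ ((p + 1) / 2))) := hupper
    _ = _ := by
      rw [mul_assoc _ (ε ^ _), ← Real.rpow_add hε, sub_add_cancel]
      ring

/-- A smooth compactly supported function that equals the coordinate `xᵢ` on the unit ball. -/
def cutoffCoord (i : Fin N) (x : Space N) : ℂ :=
  ((x i * Real.smoothTransition (2 - ‖x‖ ^ 2) : ℝ) : ℂ)

theorem contDiff_cutoffCoord (i : Fin N) : ContDiff ℝ ∞ (cutoffCoord i) := by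
  have hcutoff : ContDiff ℝ ∞ fun x : Space N ↦ Real.smoothTransition (2 - ‖x‖ ^ 2) :=
    Real.smoothTransition.contDiff.comp (contDiff_const.sub (contDiff_norm_sq ℝ))
  have hcoord : ContDiff ℝ ∞ fun x : Space N ↦ x i := by fun_prop
  exact Complex.ofRealCLM.contDiff.comp (hcoord.mul hcutoff)

theorem hasCompactSupport_cutoffCoord (i : Fin N) : HasCompactSupport (cutoffCoord i) := by
  refine HasCompactSupport.intro (isCompact_closedBall 0 2) fun x hx ↦ ?_
  rw [mem_closedBall_zero_iff, not_le] at hx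
  rw [cutoffCoord, Real.smoothTransition.zero_of_nonpos (by nlinarith), mul_zero,
    Complex.ofReal_zero]

theorem cutoffCoord_of_norm_le_one (i : Fin N) {x : Space N} (hx : ‖x‖ ≤ 1) :
    cutoffCoord i x = (x i : ℂ) := by
  rw [cutoffCoord, Real.smoothTransition.one_of_one_le, mul_one]
  nlinarith [norm_nonneg x]

theorem cutoffCoord_reflectCoord (i : Fin N) (x : Space N) :
    cutoffCoord i (reflectCoord i x) = -cutoffCoord i x := by
  simp only [cutoffCoord, LinearIsometryEquiv.norm_map, reflectCoord_apply, if_true]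
  push_cast
  ring

theorem norm_powNl_sub_le_of_norm_sub_le {α : ℝ} (hα : 0 ≤ α) {η : ℝ} (hη : η ≤ 1) {z w : ℂ}
    (h : ‖z - w‖ ≤ η * ‖w‖) :
    ‖powNl α z - powNl α w‖ ≤ (1 + α) * 2 ^ α * η * ‖powNl α w‖ := by
  have hz : ‖z‖ ≤ 2 * ‖w‖ := by
    nlinarith [norm_le_norm_add_norm_sub' z w, norm_nonneg w]
  have hw : ‖w‖ ≤ 2 * ‖w‖ := by linarith [norm_nonneg w]
  calc ‖powNl α z - powNl α w‖ ≤ (1 + α) * (2 * ‖w‖) ^ α * (η * ‖w‖) :=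
        (norm_powNl_sub_le hα hz hw).trans (by gcongr)
    _ = (1 + α) * 2 ^ α * η * ‖powNl α w‖ := by
        rw [powNl, norm_mul, Complex.norm_of_nonneg (by positivity),
          Real.mul_rpow two_pos.le (norm_nonneg w)]
        ring

theorem norm_powNl_sub_mul_powNl_le {α : ℝ} (hα : 0 ≤ α) {κ η r : ℝ} (hκ : 0 ≤ κ) {z : ℂ}
    (h : ‖z - κ * r‖ ≤ min 1 (η / ((1 + α) * 2 ^ α)) * κ * |r|) :
    ‖powNl α z - (κ ^ α * κ : ℝ) * powNl α r‖ ≤ η * (κ ^ α * κ * ‖powNl α r‖) := by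
  have hnorm : ‖(κ * r : ℂ)‖ = κ * |r| := by
    rw [norm_mul, Complex.norm_of_nonneg hκ, Complex.norm_real, Real.norm_eq_abs]
  have hle := norm_powNl_sub_le_of_norm_sub_le hα (min_le_left _ _)
    (h.trans_eq (by rw [hnorm, mul_assoc]))
  rw [powNl_ofReal_mul hκ, norm_mul, Complex.norm_of_nonneg (by positivity)] at hle
  refine hle.trans ?_
  gcongr
  rw [mul_comm, ← le_div_iff₀ (by positivity)]
  exact min_le_right _ _

theorem exists_eq_mul_cutoffCoord_hsNorm_le (i : Fin N) {s δ : ℝ} (hs : 0 ≤ s) (hδ : 0 < δ) :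
    ∃ (κ : ℝ) (Φ : 𝓢(Space N, ℂ)), 0 < κ ∧ (∀ x, Φ x = κ * cutoffCoord i x) ∧
      HasCompactSupport Φ ∧ hsNorm s Φ.toZeroAtInfty ≤ ENNReal.ofReal δ := by
  set b : 𝓢(Space N, ℂ) :=
    (hasCompactSupport_cutoffCoord i).toSchwartzMap (contDiff_cutoffCoord i)
  set E := hsEnergy s b
  have hE : 0 ≤ E := integral_nonneg fun ξ ↦ by positivity
  set κ := δ / (E + 1) with hκ
  refine ⟨κ, (κ : ℂ) • b, by positivity, fun _ ↦ rfl, (hasCompactSupport_cutoffCoord i).mul_left,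
    (hsNorm_le ((κ : ℂ) • b) fun _ ↦ rfl).trans
      (ENNReal.ofReal_le_ofReal ((Real.sqrt_le_left hδ.le).2 ?_))⟩
  calc hsEnergy s ((κ : ℂ) • b) ≤ κ ^ 2 * 1 ^ (2 * s - N) * E :=
        hsEnergy_le_of_eq_comp_smul hs le_rfl fun x ↦ by simp
    _ ≤ (κ * (E + 1)) ^ 2 := by
        rw [Real.one_rpow, mul_one, mul_pow]
        gcongr
        nlinarith
    _ = δ ^ 2 := by rw [hκ, div_mul_cancel₀ _ (by positivity)]

/-- The data `κ xᵢ`, cut off away from the origin, are odd in `xᵢ`, so for small times the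
solution stays close to `κ xᵢ` relative to `|xᵢ|`, and the nonlinearity close to a multiple of
`|xᵢ|^α xᵢ`. -/
theorem not_locallyWellPosedSmallData_of_gt (i : Fin N) {α s : ℝ} {lam : ℂ} (hα : 0 < α)
    (hα2 : α < 2) (hlam : lam ≠ 0) (hs : α + 7 / 2 < s) :
    ¬ LocallyWellPosedSmallData N s α lam := by
  rintro ⟨δ, T, hδ, hT, hwp⟩
  obtain ⟨η, hη, hloss⟩ := exists_not_forall_norm_integral_mul_le i hα hα2
  obtain ⟨κ, Φ, hκ, hΦ, hcompact, hnorm⟩ :=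
    exists_eq_mul_cutoffCoord_hsNorm_le i (s := s) (by linarith) hδ
  obtain ⟨hTmax, hmem⟩ := hwp Φ.toZeroAtInfty Φ.smooth' hcompact hnorm
  obtain ⟨u, hu⟩ := exists_isSolutionOn_maximalTime hα.le lam Φ.toZeroAtInfty
  have hlt : ENNReal.ofReal (T / 2) < maximalTime α lam Φ.toZeroAtInfty :=
    ((ENNReal.ofReal_lt_ofReal_iff hT).2 (by linarith)).trans_le hTmax
  obtain ⟨M, hv⟩ := hu.exists_isMild (half_pos hT).le hlt
  set v : ℝ → Space N → ℂ := fun t x ↦ u (projIcc 0 (T / 2) (half_pos hT).le t) x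
  have hv₀ : v 0 = Φ := by
    simp only [v, projIcc_left, hu.apply_zero (zero_le.trans_lt hlt)]
    rfl
  obtain ⟨K, hK, hodd⟩ := hv.exists_norm_sub_le_of_odd hα.le hv₀ (i := i) fun x ↦ by
    rw [hΦ, hΦ, cutoffCoord_reflectCoord, mul_neg]
  set θ := min 1 (η / ((1 + α) * 2 ^ α))
  have : 0 < θ := by positivity
  set T₁ := min (T / 2) (θ * κ / (K + 1))
  have hT₁_le : T₁ ≤ T / 2 := min_le_left _ _
  refine hloss hs (A := κ ^ α * κ) (T := T₁) hlam (by positivity) (by positivity)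
    (hv.mono hT₁_le le_rfl) (fun t ht x hx ↦ norm_powNl_sub_mul_powNl_le hα.le hκ.le ?_)
    fun t ht ↦ ?_
  · have hKt : K * t ≤ θ * κ := by
      have := (le_div_iff₀ (by positivity)).1 (ht.2.trans (min_le_right _ _))
      linarith [ht.1]
    rw [← cutoffCoord_of_norm_le_one i hx, ← hΦ]
    exact (hodd t ⟨ht.1, ht.2.trans hT₁_le⟩ x).trans
      (mul_le_mul_of_nonneg_right hKt (abs_nonneg _))
  · have htT : t ∈ Icc 0 (T / 2) := ⟨ht.1, ht.2.trans hT₁_le⟩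
    obtain ⟨B, -, hB⟩ := (hmem u hu t ht.1 (by linarith [htT.2])
      ((ENNReal.ofReal_le_ofReal htT.2).trans_lt hlt)).exists_norm_integral_mul_le
    exact ⟨B, by simpa only [v, projIcc_of_mem _ htT] using hB⟩

end NLHeat

end

theorem theorem1p6_general (N : ℕ) (α lam : ℝ) (hα : 0 < α) (hα2 : α < 2) (hlam : 0 < lam)
    (hN : 7 + 2 * α + 4 / α < N) (s : ℝ) (hs : 0 ≤ s) :
    ¬ NLHeat.LocallyWellPosedSmallData N s α (lam : ℂ) := by
  rcases lt_or_ge s (N / 2 - 2 / α) with hlt | hge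
  · exact NLHeat.not_locallyWellPosedSmallData_of_lt hα hlam hs hlt
  · have hhalf : 4 / α = 2 * (2 / α) := by ring
    have hpos : 0 < N := by exact_mod_cast (by positivity : 0 < 7 + 2 * α + 4 / α).trans hN
    exact NLHeat.not_locallyWellPosedSmallData_of_gt ⟨0, hpos⟩ hα hα2
      (Complex.ofReal_ne_zero.2 hlam.ne') (by linarith)

theorem theorem1p6 (N : ℕ) (α lam : ℝ) (hα : 0 < α) (hα2 : α < 2) (hlam : 0 < lam)
    (hN : (N : ℝ) > 11 + 4 / α) (s : ℝ) (hs : 0 ≤ s) :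
    ¬ NLHeat.LocallyWellPosedSmallData N s α (lam : ℂ) :=
  theorem1p6_general N α lam hα hα2 hlam (by linarith) s hs
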